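/- All DFAs $M=(Q,\Sigma,\delta,q_0,F)$ below are complete, with finite state set $Q$ and finite alphabet $\Sigma$; $\delta$ is extended to words. For $L\subseteq\Sigma^*$ let $\mathrm{Fact}(L)$ be the set of all $y\in\Sigma^*$ such that $xyz\in L$ for some $x,z\in\Sigma^*$. A state $q$ of $M$ is reachable if $\delta(q_0,x)=q$ for some $x\in\Sigma^*$; it is dead if $\delta(q,x)\notin F$ for all $x\in\Sigma^*$; it is universal if $\delta(q,x)$ is not dead for all $x\in\Sigma^*$. $M$ is initially connected if all its states are reachable. A synchronizing word for $M$ is a word $w$ with $\delta(p,w)=\delta(q,w)$ for all states $p,q$. Theorem. (1) The decision problem "Given a DFA $M$ with input alphabet $\Sigma$, is $\mathrm{Fact}(L(M))=\Sigma^*$?" is solvable in polynomial time. (2) The decision problem "Given a DFA $M$, does $M$ have a synchronizing word?" is solvable in polynomial time. (3) If $M$ is initially connected, has no universal state, and has exactly one dead state, then there exists $x\notin\mathrm{Fact}(L(M))$ if and only if there is a synchronizing word for $M$. (4) If $M$ has a reachable universal state, then $\mathrm{Fact}(L(M))=\Sigma^*$. (5) Let $M'$ be the DFA obtained from $M$ by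 removing all states that are not reachable and then merging all dead states (if there are any) into one. Then $L(M')=L(M)$, $M'$ is initially connected, and $M'$ has a universal state if and only if $M$ has a reachable universal state. If $M$ has no reachable universal state, then $M'$ has exactly one dead state, and $\mathrm{Fact}(L(M))\neq\Sigma^*$ if and only if $M'$ has a synchronizing word. In (1) and (2), a DFA with states $0,\dots,n-1$ and letters $0,\dots,k-1$ is given by a binary word that lists $n$, $k$, the start state, one bit for each state telling whether it is accepting, and the transition table, and polynomial time means that a (multi-stack) Turing machine halts with the correct answer after a number of steps bounded by a polynomial in the length of this word. -/

import Mathlib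

universe u v

namespace Language

/-- `Fact(L)`: the set of all factors (contiguous subwords) of words of `L`. -/
def factors {α : Type u} (L : Language α) : Language α :=
  {y | ∃ w ∈ L, ∃ x z : List α, w = x ++ y ++ z}

end Language

namespace DFA

variable {α : Type u} {σ : Type v}

/-- A state is dead if no accepting state can be reached from it by a possibly empty path. -/
def IsDead (M : DFA α σ) (q : σ) : Prop :=
  ∀ x : List α, M.evalFrom q x ∉ M.accept

/-- A state is universal if no dead state can be reached from it by a possibly empty path. -/
def IsUniversalState (M : DFA α σ) (r : σ) : Prop :=
  ∀ x : List α, ¬ M.IsDead (M.evalFrom r x)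

/-- A state is reachable if there is a path to it from the start state. -/
def IsReachable (M : DFA α σ) (q : σ) : Prop :=
  ∃ x : List α, M.eval x = q

/-- All states are reachable. -/
def InitiallyConnected (M : DFA α σ) : Prop :=
  ∀ q : σ, M.IsReachable q

/-- `w` leads all states to one and the same state. -/
def IsSynchronizingWord (M : DFA α σ) (w : List α) : Prop :=
  ∀ p q : σ, M.evalFrom p w = M.evalFrom q w

def HasSynchronizingWord (M : DFA α σ) : Prop :=
  ∃ w : List α, M.IsSynchronizingWord w

theorem IsReachable.step {M : DFA α σ} {q : σ} (h : M.IsReachable q) (a : α) :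
    M.IsReachable (M.step q a) := by
  obtain ⟨x, rfl⟩ := h
  exact ⟨x ++ [a], M.eval_append_singleton x a⟩

theorem IsDead.step {M : DFA α σ} {q : σ} (h : M.IsDead q) (a : α) :
    M.IsDead (M.step q a) :=
  fun x => h (a :: x)

/-- The DFA obtained by removing all states that are not reachable. -/
def trim (M : DFA α σ) : DFA α {q : σ // M.IsReachable q} where
  step q a := ⟨M.step q.1 a, q.2.step a⟩
  start := ⟨M.start, [], rfl⟩
  accept := {q | q.1 ∈ M.accept}

/-- Two states are identified if they are equal or both dead. -/
def deadSetoid (M : DFA α σ) : Setoid σ where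
  r p q := p = q ∨ (M.IsDead p ∧ M.IsDead q)
  iseqv :=
    { refl := fun _ => Or.inl rfl
      symm := by
        rintro p q (h | ⟨hp, hq⟩)
        · exact Or.inl h.symm
        · exact Or.inr ⟨hq, hp⟩
      trans := by
        rintro p q r (rfl | ⟨hp, hq⟩) (rfl | ⟨hq', hr⟩)
        · exact Or.inl rfl
        · exact Or.inr ⟨hq', hr⟩
        · exact Or.inr ⟨hp, hq⟩
        · exact Or.inr ⟨hp, hr⟩ }

/-- The DFA obtained by merging all dead states into a single one
(nothing changes if there is no dead state). -/
def mergeDead (M : DFA α σ) : DFA α (Quotient M.deadSetoid) where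
  step c a := Quotient.map' (s₁ := M.deadSetoid) (s₂ := M.deadSetoid) (fun q => M.step q a)
    (by
      rintro p q (rfl | ⟨hp, hq⟩)
      · exact Or.inl rfl
      · exact Or.inr ⟨hp.step a, hq.step a⟩) c
  start := Quotient.mk M.deadSetoid M.start
  accept := {c | ∃ q ∈ M.accept, Quotient.mk M.deadSetoid q = c}

end DFA

/-- An input of the decision problems: a complete DFA whose states are numbered
`0, …, states - 1` and whose letters are numbered `0, …, letters - 1`. -/
structure DFAInput where
  states : ℕ
  letters : ℕ
  dfa : DFA (Fin letters) (Fin states)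

namespace DFAInput

open Classical in
/-- The description of a DFA as a list of numbers: the number of states, the number of letters,
the start state, one bit for each state (`1` if it is accepting and `0` if not), and the
transition table row by row. -/
noncomputable def numbers (A : DFAInput) : List ℕ :=
  [A.states, A.letters, (A.dfa.start : ℕ)] ++
    ((List.finRange A.states).map (fun q => if q ∈ A.dfa.accept then 1 else 0) ++
      (List.finRange A.states).flatMap (fun q =>
        (List.finRange A.letters).map (fun a => (A.dfa.step q a : ℕ))))

/-- A list of numbers as a binary word; the number `m` is written as `1 ⋯ 1 0` with `m` ones. -/
def unaryCode (l : List ℕ) : List Bool :=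
  l.flatMap (fun m => List.replicate m true ++ [false])

/-- The word over `{0, 1}` that is given to a machine. Its length is polynomial in the numbers
of states and letters (see `length_encode_le`), and it determines the DFA
(see `encode_injective`). -/
noncomputable def encode (A : DFAInput) : List Bool :=
  unaryCode A.numbers

theorem unaryCode_injective : Function.Injective unaryCode := by
  have key : ∀ (m n : ℕ) (s t : List Bool),
      List.replicate m true ++ false :: s = List.replicate n true ++ false :: t →
        m = n ∧ s = t := by
    intro m
    induction m with
    | zero =>
      intro n s t h
      cases n with
      | zero => simpa using h
      | succ n => simp [List.replicate_succ] at h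
    | succ m ih =>
      intro n s t h
      cases n with
      | zero => simp [List.replicate_succ] at h
      | succ n =>
        simp only [List.replicate_succ, List.cons_append, List.cons.injEq, true_and] at h
        obtain ⟨h1, h2⟩ := ih n s t h
        exact ⟨by rw [h1], h2⟩
  intro l
  induction l with
  | nil =>
    intro l' h
    cases l' with
    | nil => rfl
    | cons b l' => simp [unaryCode] at h
  | cons a l ih =>
    intro l' h
    cases l' with
    | nil => simp [unaryCode] at h
    | cons b l' =>
      simp only [unaryCode, List.flatMap_cons, List.append_assoc, List.singleton_append] at h
      obtain ⟨h1, h2⟩ := key _ _ _ _ h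
      rw [h1, ih h2]

theorem encode_injective : Function.Injective encode := by
  have key : ∀ {ι : Type} (l : List ι) (f g : ι → List ℕ), (∀ i, (f i).length = (g i).length) →
      l.flatMap f = l.flatMap g → ∀ i ∈ l, f i = g i := by
    intro ι l f g hl
    induction l with
    | nil => simp
    | cons a l ih =>
      intro h
      simp only [List.flatMap_cons] at h
      obtain ⟨h1, h2⟩ := List.append_inj h (hl a)
      intro i hi
      rcases List.mem_cons.1 hi with rfl | hi
      · exact h1
      · exact ih h2 i hi
  rintro ⟨n, k, M⟩ ⟨n', k', M'⟩ h
  have h' := unaryCode_injective h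
  simp only [numbers, List.cons_append, List.nil_append, List.cons.injEq] at h'
  obtain ⟨rfl, rfl, h1, h2⟩ := h'
  obtain ⟨h3, h4⟩ := List.append_inj h2 (by simp)
  obtain ⟨st, s, F⟩ := M
  obtain ⟨st', s', F'⟩ := M'
  have e1 : s = s' := Fin.ext h1
  have e2 : F = F' := by
    ext q
    have h5 := List.map_inj_left.1 h3 q (List.mem_finRange q)
    by_cases hq : q ∈ F <;> by_cases hq' : q ∈ F' <;> simp_all
  have e3 : st = st' := by
    funext q a
    have h5 := key _ _ _ (fun i => by simp) h4 q (List.mem_finRange q)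
    exact Fin.ext (List.map_inj_left.1 h5 a (List.mem_finRange a))
  rw [e1, e2, e3]

theorem length_encode_le (A : DFAInput) :
    A.encode.length ≤ A.states ^ 2 * A.letters + 4 * A.states + A.letters + 2 := by
  have hc : ∀ l : List ℕ, (unaryCode l).length = (l.map (· + 1)).sum := by
    intro l
    simp [unaryCode, List.length_flatMap]
  have hb : ∀ (l : List ℕ) (c : ℕ), (∀ m ∈ l, m + 1 ≤ c) →
      (unaryCode l).length ≤ l.length * c := by
    intro l c h
    rw [hc]
    have h' := List.sum_le_card_nsmul (l.map (· + 1)) c (by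
      intro m hm
      obtain ⟨i, hi, rfl⟩ := List.mem_map.1 hm
      exact h i hi)
    rwa [List.length_map, smul_eq_mul] at h'
  have happ : ∀ l l' : List ℕ, (unaryCode (l ++ l')).length =
      (unaryCode l).length + (unaryCode l').length := by
    intro l l'
    simp [unaryCode]
  obtain ⟨n, k, M⟩ := A
  simp only [encode, numbers]
  rw [happ, happ]
  have h1 : (unaryCode [n, k, (M.start : ℕ)]).length ≤ n + 1 + (k + 1) + n := by
    rw [hc]
    have := M.start.2
    simp
    omega
  have h2 := hb ((List.finRange n).map (fun q => by classical exact
    if q ∈ M.accept then 1 else 0)) 2 (by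
      intro m hm
      obtain ⟨q, -, rfl⟩ := List.mem_map.1 hm
      split_ifs <;> omega)
  have h3 := hb ((List.finRange n).flatMap (fun q =>
        (List.finRange k).map (fun a => (M.step q a : ℕ)))) n (by
      intro m hm
      obtain ⟨q, -, hm⟩ := List.mem_flatMap.1 hm
      obtain ⟨a, -, rfl⟩ := List.mem_map.1 hm
      exact (M.step q a).2)
  simp only [List.length_map, List.length_finRange, List.length_flatMap, List.map_const',
    List.sum_replicate, smul_eq_mul] at h2 h3
  nlinarith [h1, h2, h3]

open Classical in
/-- A property of DFAs is decidable in polynomial time: some Turing machine, started on the word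
that describes `A`, halts with output `1` if `P A` holds and with output `0` if not, after a
number of steps that is bounded by a polynomial in the length of this word. -/
def PolyTimeDecidable (P : DFAInput → Prop) : Prop :=
  Nonempty (Turing.TM2ComputableInPolyTime encode Computability.encodeBool
    (fun A => decide (P A)))

end DFAInput

/-! A word `y` is a factor of the language exactly when it leads some reachable state to a state
that is not dead. So a word outside the factors is one that kills all reachable states. If no
reachable state is universal, such a word exists: the reachable states are killed one after the
other, since the current image of each of them is again reachable and can therefore be led to a dead
state, while states already killed stay dead. Hence the factors are universal iff a reachable
universal state exists (`factors_accepts_eq_top_iff`). If all states are reachable and there is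
exactly one dead state, killing all states means synchronizing them, because the dead state is never
left (`exists_notMem_factors_iff`). Trimming and merging dead states preserve the language, deadness
and universality, and without a reachable universal state some dead state is reachable.

Both decision problems are thereby backward reachability. The existence of a reachable universal
state is expressed by three backward closures with complements between them
(`factors_accepts_eq_top_iff_coreach`). A synchronizing word exists iff every pair of states can be
merged, that is, iff the diagonal is reachable from every state of the square automaton
(`hasSynchronizingWord_iff_coreach`). By pumping, a backward closure is complete after as many
rounds of marking predecessors as there are states.

For the time bound, the algorithms are written in a register language `Cmd` whose loops run only as
often as there are states or letters. The number of instructions is then automatically polynomial.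
Each instruction raises the bound on numbers and addresses by at most one, so its simulation on
unary stacks takes quadratically many steps in a polynomially bounded number (`simulated`). Stack
programs in turn compile to Turing machines without loss of time (`Exec.reachesIn`). What remains is
the correctness of two commands (`run_universal`, `run_synchronizing`). -/

/-! ### Structured stack programs and their translation into Turing machines. -/

/-- Structured programs over stacks of bits. -/
inductive StackProg (K : Type) : Type
  | skip : StackProg K
  | push (k : K) (b : Bool) : StackProg K
  | pop (k : K) : StackProg K
  | seq (p q : StackProg K) : StackProg K
  | ite (k : K) (c : Option Bool → Bool) (p q : StackProg K) : StackProg K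
  | while (k : K) (c : Option Bool → Bool) (p : StackProg K) : StackProg K

namespace StackProg

open Turing Function

variable {K : Type}

infixr:60 " ;; " => StackProg.seq

/-- `Exec p S t S'`: started on the stacks `S`, the program `p` halts with stacks `S'`
after `t` steps. -/
inductive Exec [DecidableEq K] : StackProg K → (K → List Bool) → ℕ → (K → List Bool) → Prop
  | skip (S : K → List Bool) : Exec skip S 1 S
  | push (k : K) (b : Bool) (S : K → List Bool) : Exec (push k b) S 1 (update S k (b :: S k))
  | pop (k : K) (S : K → List Bool) : Exec (pop k) S 1 (update S k (S k).tail)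
  | seq {p q : StackProg K} {S S' S'' : K → List Bool} {t t' : ℕ} :
      Exec p S t S' → Exec q S' t' S'' → Exec (p ;; q) S (t + t') S''
  | ite_true {k : K} {c : Option Bool → Bool} {p q : StackProg K} {S S' : K → List Bool} {t : ℕ} :
      c (S k).head? = true → Exec p S t S' → Exec (ite k c p q) S (1 + t) S'
  | ite_false {k : K} {c : Option Bool → Bool} {p q : StackProg K} {S S' : K → List Bool} {t : ℕ} :
      c (S k).head? = false → Exec q S t S' → Exec (ite k c p q) S (1 + t) S'
  | while_false {k : K} {c : Option Bool → Bool} {p : StackProg K} {S : K → List Bool} :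
      c (S k).head? = false → Exec (StackProg.while k c p) S 1 S
  | while_true {k : K} {c : Option Bool → Bool} {p : StackProg K} {S S' S'' : K → List Bool}
      {t t' : ℕ} :
      c (S k).head? = true → Exec p S t S' → Exec (StackProg.while k c p) S' t' S'' →
        Exec (StackProg.while k c p) S (1 + t + t') S''

/-- The labels of the machine code of a program. -/
def Label : StackProg K → Type
  | skip => Unit
  | push _ _ => Unit
  | pop _ => Unit
  | seq p q => Label p ⊕ Label q
  | ite _ _ p q => Option (Label p ⊕ Label q)
  | StackProg.while _ _ p => Option (Label p)

noncomputable instance Label.fintype : (p : StackProg K) → Fintype (Label p)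
  | skip => inferInstanceAs (Fintype Unit)
  | push _ _ => inferInstanceAs (Fintype Unit)
  | pop _ => inferInstanceAs (Fintype Unit)
  | seq p q =>
    haveI := Label.fintype p
    haveI := Label.fintype q
    inferInstanceAs (Fintype (Label p ⊕ Label q))
  | ite _ _ p q =>
    haveI := Label.fintype p
    haveI := Label.fintype q
    inferInstanceAs (Fintype (Option (Label p ⊕ Label q)))
  | StackProg.while _ _ p =>
    haveI := Label.fintype p
    inferInstanceAs (Fintype (Option (Label p)))

/-- The label where the execution starts. -/
def entry : (p : StackProg K) → Label p
  | skip => ()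
  | push _ _ => ()
  | pop _ => ()
  | seq p _ => Sum.inl (entry p)
  | ite _ _ _ _ => none
  | StackProg.while _ _ _ => none

/-- Statements of machines whose stacks hold bits and which remember one symbol. -/
abbrev BitStmt (K Λ : Type) : Type :=
  TM2.Stmt (fun _ : K => Bool) Λ (Option Bool)

/-- The machine code of a program, for labels embedded by `emb` and ending with a jump
to `next`. -/
def code {Λ : Type} : (p : StackProg K) → (emb : Label p → Λ) → (next : Λ) → Label p → BitStmt K Λ
  | skip, _, next => fun _ => .goto fun _ => next
  | push k b, _, next => fun _ => .push k (fun _ => b) (.goto fun _ => next)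
  | pop k, _, next => fun _ => .pop k (fun v _ => v) (.goto fun _ => next)
  | seq p q, emb, next =>
    Sum.elim (code p (emb ∘ Sum.inl) (emb (Sum.inr (entry q)))) (code q (emb ∘ Sum.inr) next)
  | ite k c p q, emb, next => fun l =>
    match l with
    | none => .peek k (fun _ o => o) (.branch c (.goto fun _ => emb (some (Sum.inl (entry p))))
        (.goto fun _ => emb (some (Sum.inr (entry q)))))
    | some (Sum.inl l) => code p (fun l => emb (some (Sum.inl l))) next l
    | some (Sum.inr l) => code q (fun l => emb (some (Sum.inr l))) next l
  | StackProg.while k c p, emb, next => fun l =>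
    match l with
    | none => .peek k (fun _ o => o) (.branch c (.goto fun _ => emb (some (entry p)))
        (.goto fun _ => next))
    | some l => code p (fun l => emb (some l)) (emb none) l

/-- The machine reaches the configuration `b` from `a` in `t` steps. -/
def ReachesIn {Λ : Type} [DecidableEq K] (M : Λ → BitStmt K Λ) (t : ℕ)
    (a b : TM2.Cfg (fun _ : K => Bool) Λ (Option Bool)) : Prop :=
  (flip bind (TM2.step M))^[t] (some a) = some b

section

variable {Λ : Type} [DecidableEq K] {M : Λ → BitStmt K Λ}

theorem ReachesIn.trans {t t' : ℕ} {a b c : TM2.Cfg (fun _ : K => Bool) Λ (Option Bool)}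
    (h : ReachesIn M t a b) (h' : ReachesIn M t' b c) : ReachesIn M (t + t') a c := by
  unfold ReachesIn at *
  rw [Nat.add_comm, Function.iterate_add_apply, h, h']

theorem reachesIn_one {l : Λ} {s : BitStmt K Λ} (h : M l = s) (v : Option Bool)
    (S : K → List Bool) : ReachesIn M 1 ⟨some l, v, S⟩ (TM2.stepAux s v S) := by
  subst h
  rfl

/-- A test costs a single machine step, because peek, branch and jump form one statement; so the
step counts agree exactly. The label embedding and the exit label are arbitrary since subprograms
sit inside larger machines. The remembered symbol `v` is irrelevant because each test overwrites it
before branching. -/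
theorem Exec.reachesIn {p : StackProg K} {S S' : K → List Bool} {t : ℕ} (h : Exec p S t S') :
    ∀ {emb : Label p → Λ} {next : Λ}, (∀ l, M (emb l) = code p emb next l) →
      ∀ v, ∃ v', ReachesIn M t ⟨some (emb (entry p)), v, S⟩ ⟨some next, v', S'⟩ := by
  induction h with
  | skip S =>
    intro emb next hM v
    exact ⟨v, reachesIn_one (hM ()) v S⟩
  | push k b S =>
    intro emb next hM v
    exact ⟨v, reachesIn_one (hM ()) v S⟩
  | pop k S =>
    intro emb next hM v
    exact ⟨v, reachesIn_one (hM ()) v S⟩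
  | @seq p q S S' S'' t t' _ _ ih ih' =>
    intro emb next hM v
    obtain ⟨v₁, h₁⟩ := ih (emb := emb ∘ Sum.inl) (next := emb (Sum.inr (entry q)))
      (fun l => hM (Sum.inl l)) v
    obtain ⟨v₂, h₂⟩ := ih' (emb := emb ∘ Sum.inr) (next := next) (fun l => hM (Sum.inr l)) v₁
    exact ⟨v₂, h₁.trans h₂⟩
  | @ite_true k c p q S S' t hc _ ih =>
    intro emb next hM v
    obtain ⟨v₁, h₁⟩ := ih (emb := fun l => emb (some (Sum.inl l))) (next := next)
      (fun l => hM (some (Sum.inl l))) (S k).head?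
    have h₀ := reachesIn_one (hM none) v S
    simp only [code, TM2.stepAux, hc, cond_true] at h₀
    exact ⟨v₁, h₀.trans h₁⟩
  | @ite_false k c p q S S' t hc _ ih =>
    intro emb next hM v
    obtain ⟨v₁, h₁⟩ := ih (emb := fun l => emb (some (Sum.inr l))) (next := next)
      (fun l => hM (some (Sum.inr l))) (S k).head?
    have h₀ := reachesIn_one (hM none) v S
    simp only [code, TM2.stepAux, hc, cond_false] at h₀
    exact ⟨v₁, h₀.trans h₁⟩
  | @while_false k c p S hc =>
    intro emb next hM v
    have h₀ := reachesIn_one (hM none) v S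
    simp only [code, TM2.stepAux, hc, cond_false] at h₀
    exact ⟨_, h₀⟩
  | @while_true k c p S S' S'' t t' hc _ _ ih ih' =>
    intro emb next hM v
    obtain ⟨v₁, h₁⟩ := ih (emb := fun l => emb (some l)) (next := emb none)
      (fun l => hM (some l)) (S k).head?
    obtain ⟨v₂, h₂⟩ := ih' hM v₁
    have h₀ := reachesIn_one (hM none) v S
    simp only [code, TM2.stepAux, hc, cond_true] at h₀
    exact ⟨v₂, (h₀.trans h₁).trans h₂⟩

end

/-- The machine that runs a program and halts. -/
noncomputable def machine [DecidableEq K] [Fintype K] (k₀ k₁ : K) (p : StackProg K) : FinTM2 where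
  K := K
  k₀ := k₀
  k₁ := k₁
  Γ _ := Bool
  Λ := Option (Label p)
  main := some (entry p)
  σ := Option Bool
  initialState := none
  m l :=
    match l with
    -- A final configuration in the sense of `haltList` has the initial internal state, so the
    -- remembered symbol is erased before halting.
    | none => .load (fun _ => none) .halt
    | some l => code p some none l

theorem dite_eq_update [DecidableEq K] (k₀ : K) (s : List Bool) (k : K)
    (c : k = k₀ → List Bool) (hc : ∀ h, c h = s) :
    (if h : k = k₀ then c h else []) = update (fun _ => []) k₀ s k := by
  by_cases hk : k = k₀
  · rw [dif_pos hk, hc, hk, update_self]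
  · rw [dif_neg hk, update_of_ne hk]

/-- A program that computes `f` within a polynomial number of steps yields a Turing machine. -/
theorem computableInPolyTime [DecidableEq K] [Fintype K] {α β : Type} {ea : α → List Bool}
    {eb : β → List Bool} {f : α → β} (k₀ k₁ : K) (p : StackProg K) (time : Polynomial ℕ)
    (h : ∀ a, ∃ t ≤ time.eval (ea a).length,
      Exec p (update (fun _ => []) k₀ (ea a)) t (update (fun _ => []) k₁ (eb (f a)))) :
    Nonempty (TM2ComputableInPolyTime ea eb f) := by
  -- The additional step is the one that halts.
  refine ⟨⟨⟨machine k₀ k₁ p, Equiv.refl Bool, Equiv.refl Bool⟩, time + 1, fun a => ?_⟩⟩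
  apply Classical.choice
  obtain ⟨t, ht, he⟩ := h a
  obtain ⟨v, hv⟩ := he.reachesIn (M := (machine k₀ k₁ p).m) (emb := some) (next := none)
    (fun l => rfl) none
  have h₁ := hv.trans (reachesIn_one (l := none) rfl v _)
  have e₀ : initList (machine k₀ k₁ p) (List.map (Equiv.refl Bool).invFun (ea a)) =
      ⟨some (some (entry p)), none, update (fun _ => []) k₀ (ea a)⟩ := by
    unfold initList
    congr 1
    funext k
    exact dite_eq_update k₀ _ k _ fun _ => List.map_id _
  have e₁ : haltList (machine k₀ k₁ p) (List.map (Equiv.refl Bool).invFun (eb (f a))) =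
      ⟨none, none, update (fun _ => []) k₁ (eb (f a))⟩ := by
    unfold haltList
    congr 1
    funext k
    exact dite_eq_update k₁ _ k _ fun _ => List.map_id _
  refine ⟨⟨⟨t + 1, ?_⟩, ?_⟩⟩
  · simp only [Option.map_some]
    rw [e₀]
    refine Eq.trans h₁ ?_
    exact congrArg some e₁.symm
  · simpa using ht

end StackProg

/-! ### Stacks that hold a unary memory and counters. -/

/-- The registers of a register machine. Memory is accessed with the address in `addr` and the
value in `acc`. -/
inductive Reg : Type
  | addr | acc | a | b | c | d | e | f
  deriving DecidableEq

instance : Fintype Reg :=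
  ⟨{.addr, .acc, .a, .b, .c, .d, .e, .f}, fun r => by cases r <;> decide⟩

/-- Counters: two scratch counters, two parameters, and the registers. -/
inductive Counter : Type
  | tmp
  | aux
  | par (b : Bool)
  | reg (r : Reg)
  deriving DecidableEq, Fintype

/-- Stacks: the memory (before and behind the head), a stack for active loops, and counters. -/
inductive Stk : Type
  | heap
  | back
  | loops
  | cnt (c : Counter)
  deriving DecidableEq, Fintype

/-- The contents of the stacks, where counters are given by numbers. -/
structure Mem : Type where
  heap : List Bool
  back : List Bool
  loops : List Bool
  cnt : Counter → ℕ

namespace Mem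

/-- The stacks described by `m`. -/
def contents (m : Mem) : Stk → List Bool
  | .heap => m.heap
  | .back => m.back
  | .loops => m.loops
  | .cnt c => List.replicate (m.cnt c) true

end Mem

namespace StackProg

open Function Mem

/-- `Within p m T m'`: the program `p` transforms `m` into `m'` in at most `T` steps. -/
def Within (p : StackProg Stk) (m : Mem) (T : ℕ) (m' : Mem) : Prop :=
  ∃ t ≤ T, Exec p m.contents t m'.contents

theorem Within.mono {p : StackProg Stk} {m m' : Mem} {T T' : ℕ} (h : Within p m T m')
    (hT : T ≤ T') : Within p m T' m' :=
  let ⟨t, ht, he⟩ := h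
  ⟨t, ht.trans hT, he⟩

theorem Within.seq {p q : StackProg Stk} {m m' m'' : Mem} {T T' : ℕ} (h : Within p m T m')
    (h' : Within q m' T' m'') : Within (p ;; q) m (T + T') m'' :=
  let ⟨t, ht, he⟩ := h
  let ⟨t', ht', he'⟩ := h'
  ⟨t + t', Nat.add_le_add ht ht', he.seq he'⟩

theorem within_skip (m : Mem) : Within skip m 1 m :=
  ⟨1, le_rfl, .skip _⟩

theorem within_push_heap (m : Mem) (b : Bool) :
    Within (push .heap b) m 1 { m with heap := b :: m.heap } := by
  refine ⟨1, le_rfl, ?_⟩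
  convert Exec.push .heap b m.contents using 1
  funext k
  cases k <;> simp [contents, update]

theorem within_push_back (m : Mem) (b : Bool) :
    Within (push .back b) m 1 { m with back := b :: m.back } := by
  refine ⟨1, le_rfl, ?_⟩
  convert Exec.push .back b m.contents using 1
  funext k
  cases k <;> simp [contents, update]

theorem within_push_loops (m : Mem) (b : Bool) :
    Within (push .loops b) m 1 { m with loops := b :: m.loops } := by
  refine ⟨1, le_rfl, ?_⟩
  convert Exec.push .loops b m.contents using 1
  funext k
  cases k <;> simp [contents, update]

theorem within_pop_heap (m : Mem) :
    Within (pop .heap) m 1 { m with heap := m.heap.tail } := by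
  refine ⟨1, le_rfl, ?_⟩
  convert Exec.pop .heap m.contents using 1
  funext k
  cases k <;> simp [contents, update]

theorem within_pop_back (m : Mem) :
    Within (pop .back) m 1 { m with back := m.back.tail } := by
  refine ⟨1, le_rfl, ?_⟩
  convert Exec.pop .back m.contents using 1
  funext k
  cases k <;> simp [contents, update]

theorem within_pop_loops (m : Mem) :
    Within (pop .loops) m 1 { m with loops := m.loops.tail } := by
  refine ⟨1, le_rfl, ?_⟩
  convert Exec.pop .loops m.contents using 1
  funext k
  cases k <;> simp [contents, update]

theorem within_push_cnt (m : Mem) (c : Counter) :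
    Within (push (.cnt c) true) m 1 { m with cnt := update m.cnt c (m.cnt c + 1) } := by
  refine ⟨1, le_rfl, ?_⟩
  convert Exec.push (.cnt c) true m.contents using 1
  funext k
  cases k with
  | cnt d =>
    by_cases h : d = c
    · subst h
      simp [contents, List.replicate_succ]
    · simp [contents, update, h]
  | _ => simp [contents, update]

theorem within_pop_cnt (m : Mem) (c : Counter) :
    Within (pop (.cnt c)) m 1 { m with cnt := update m.cnt c (m.cnt c - 1) } := by
  refine ⟨1, le_rfl, ?_⟩
  convert Exec.pop (.cnt c) m.contents using 1
  funext k
  cases k with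
  | cnt d =>
    by_cases h : d = c
    · subst h
      simp [contents]
    · simp [contents, update, h]
  | _ => simp [contents, update]

/-- A loop whose body runs through the states `μ 0, …, μ n`. -/
theorem within_while {k : Stk} {c : Option Bool → Bool} {p : StackProg Stk} (μ : ℕ → Mem)
    (n T : ℕ) (hc : ∀ i < n, c ((μ i).contents k).head? = true)
    (hp : ∀ i < n, Within p (μ i) T (μ (i + 1))) (hn : c ((μ n).contents k).head? = false) :
    Within (StackProg.while k c p) (μ 0) (n * (T + 1) + 1) (μ n) := by
  induction n generalizing μ with
  | zero => exact ⟨1, by omega, .while_false hn⟩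
  | succ n ih =>
    obtain ⟨t, ht, he⟩ := hp 0 (by omega)
    obtain ⟨t', ht', he'⟩ := ih (fun i => μ (i + 1)) (fun i hi => hc _ (by omega))
      (fun i hi => hp _ (by omega)) hn
    exact ⟨1 + t + t', by rw [Nat.add_mul]; omega, .while_true (hc 0 (by omega)) he he'⟩

/-- Empties a counter. -/
def clear (c : Counter) : StackProg Stk :=
  StackProg.while (.cnt c) Option.isSome (pop (.cnt c))

/-- Adds one counter to another and empties it. -/
def move (c c' : Counter) : StackProg Stk :=
  StackProg.while (.cnt c) Option.isSome (pop (.cnt c) ;; push (.cnt c') true)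

/-- Adds one counter to two others and empties it. -/
def moveBoth (c c' c'' : Counter) : StackProg Stk :=
  StackProg.while (.cnt c) Option.isSome
    (pop (.cnt c) ;; push (.cnt c') true ;; push (.cnt c'') true)

theorem isSome_head?_replicate (n : ℕ) :
    (List.replicate n true).head?.isSome = decide (n ≠ 0) := by
  cases n <;> simp [List.replicate_succ]

theorem within_clear (m : Mem) (c : Counter) :
    Within (clear c) m (2 * m.cnt c + 1) { m with cnt := update m.cnt c 0 } := by
  have h := within_while (k := .cnt c) (c := Option.isSome) (p := pop (.cnt c))
    (fun i => { m with cnt := update m.cnt c (m.cnt c - i) }) (m.cnt c) 1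
    (fun i hi => by simp [contents, isSome_head?_replicate]; omega)
    (fun i hi => by
      convert within_pop_cnt _ c using 2
      simp [Nat.sub_sub]) (by simp [contents])
  simp only [Nat.sub_zero, update_eq_self, Nat.sub_self] at h
  exact h.mono (by omega)

theorem within_move (m : Mem) {c c' : Counter} (hc : c ≠ c') :
    Within (move c c') m (3 * m.cnt c + 1)
      { m with cnt := update (update m.cnt c 0) c' (m.cnt c' + m.cnt c) } := by
  have h := within_while (k := .cnt c) (c := Option.isSome)
    (p := pop (.cnt c) ;; push (.cnt c') true)
    (fun i => { m with cnt := update (update m.cnt c (m.cnt c - i)) c' (m.cnt c' + i) })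
    (m.cnt c) 2
    (fun i hi => by simp [contents, isSome_head?_replicate, hc]; omega)
    (fun i hi => by
      convert (within_pop_cnt _ c).seq (within_push_cnt _ c') using 2
      simp only [update_of_ne hc, update_of_ne hc.symm, update_self, update_comm hc.symm,
        update_idem]
      simp [Nat.sub_sub, add_assoc, update_comm hc])
    (by simp [contents, hc])
  simp only [Nat.sub_zero, update_eq_self, Nat.sub_self, Nat.add_zero] at h
  exact h.mono (by omega)

theorem within_moveBoth (m : Mem) {c c' c'' : Counter} (h₁ : c ≠ c') (h₂ : c ≠ c'')
    (h₃ : c' ≠ c'') :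
    Within (moveBoth c c' c'') m (4 * m.cnt c + 1)
      { m with
        cnt := update (update (update m.cnt c 0) c' (m.cnt c' + m.cnt c)) c''
          (m.cnt c'' + m.cnt c) } := by
  have h := within_while (k := .cnt c) (c := Option.isSome)
    (p := pop (.cnt c) ;; push (.cnt c') true ;; push (.cnt c'') true)
    (fun i => { m with
      cnt := update (update (update m.cnt c (m.cnt c - i)) c' (m.cnt c' + i)) c''
        (m.cnt c'' + i) })
    (m.cnt c) 3
    (fun i hi => by simp [contents, isSome_head?_replicate, h₁, h₂]; omega)
    (fun i hi => by
      convert (within_pop_cnt _ c).seq ((within_push_cnt _ c').seq (within_push_cnt _ c'')) using 2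
      funext d
      by_cases d₁ : d = c
      · subst d₁; simp [h₁, h₂, Nat.sub_sub]
      by_cases d₂ : d = c'
      · subst d₂; simp [h₁.symm, h₃, add_assoc]
      by_cases d₃ : d = c''
      · subst d₃; simp [h₂.symm, h₃.symm, add_assoc]
      simp [d₁, d₂, d₃])
    (by simp [contents, h₁, h₂])
  simp only [Nat.sub_zero, update_eq_self, Nat.sub_self, Nat.add_zero] at h
  exact h.mono (by omega)

/-- Moves the ones on top of the memory behind the head. -/
def skipOnes : StackProg Stk :=
  StackProg.while .heap (· == some true) (pop .heap ;; push .back true)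

/-- Moves the ones on top of the memory behind the head and counts them. -/
def readOnes : StackProg Stk :=
  StackProg.while .heap (· == some true)
    (pop .heap ;; push .back true ;; push (.cnt (.reg .acc)) true)

/-- Removes the ones on top of the memory. -/
def dropOnes : StackProg Stk :=
  StackProg.while .heap (· == some true) (pop .heap)

/-- Writes as many ones as the value of `acc`, and adds this value to `aux`. -/
def writeOnes : StackProg Stk :=
  StackProg.while (.cnt (.reg .acc)) Option.isSome
    (pop (.cnt (.reg .acc)) ;; push .heap true ;; push (.cnt .aux) true)

/-- Moves everything behind the head back into the memory. -/
def rewind : StackProg Stk :=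
  StackProg.while .back Option.isSome (ite .back (· == some true) (pop .back ;; push .heap true)
    (pop .back ;; push .heap false))

/-- Moves as many memory cells as the value of `addr` behind the head, and adds this value
to `tmp`. -/
def seek : StackProg Stk :=
  StackProg.while (.cnt (.reg .addr)) Option.isSome
    (pop (.cnt (.reg .addr)) ;; push (.cnt .tmp) true ;; skipOnes ;; pop .heap ;; push .back false)

theorem head?_replicate_append {j : ℕ} (hj : 0 < j) (w : List Bool) :
    (List.replicate j true ++ w).head? = some true := by
  obtain ⟨j, rfl⟩ := Nat.exists_eq_succ_of_ne_zero hj.ne'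
  rfl

theorem tail_replicate_append {j : ℕ} (hj : 0 < j) (w : List Bool) :
    (List.replicate j true ++ w).tail = List.replicate (j - 1) true ++ w := by
  obtain ⟨j, rfl⟩ := Nat.exists_eq_succ_of_ne_zero hj.ne'
  rfl

/-- The condition on `w` admits both a delimiter and the empty word, so the same loop also works
behind the last memory cell. -/
theorem within_skipOnes (m : Mem) (n : ℕ) {w : List Bool} (hw : w.head? ≠ some true)
    (hm : m.heap = List.replicate n true ++ w) :
    Within skipOnes m (3 * n + 1)
      { m with heap := w, back := List.replicate n true ++ m.back } := by
  have h := within_while (k := .heap) (c := (· == some true)) (p := pop .heap ;; push .back true)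
    (fun i => { m with
      heap := List.replicate (n - i) true ++ w, back := List.replicate i true ++ m.back }) n 2
    (fun i hi => by simp [contents, head?_replicate_append (Nat.sub_pos_of_lt hi)])
    (fun i hi => by
      convert (within_pop_heap _).seq (within_push_back _ true) using 2
      · simp [tail_replicate_append (Nat.sub_pos_of_lt hi), Nat.sub_sub]
      · simp [List.replicate_succ])
    (by simpa [contents] using hw)
  simp only [Nat.sub_zero, Nat.sub_self, List.replicate_zero, List.nil_append, ← hm] at h
  exact h.mono (by omega)

theorem within_readOnes (m : Mem) (n : ℕ) {w : List Bool} (hw : w.head? ≠ some true)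
    (hm : m.heap = List.replicate n true ++ w) :
    Within readOnes m (4 * n + 1)
      { m with heap := w, back := List.replicate n true ++ m.back,
               cnt := update m.cnt (.reg .acc) (m.cnt (.reg .acc) + n) } := by
  have h := within_while (k := .heap) (c := (· == some true))
    (p := pop .heap ;; push .back true ;; push (.cnt (.reg .acc)) true)
    (fun i => { m with
      heap := List.replicate (n - i) true ++ w, back := List.replicate i true ++ m.back,
      cnt := update m.cnt (.reg .acc) (m.cnt (.reg .acc) + i) }) n 3
    (fun i hi => by simp [contents, head?_replicate_append (Nat.sub_pos_of_lt hi)])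
    (fun i hi => by
      convert (within_pop_heap _).seq ((within_push_back _ true).seq
        (within_push_cnt _ (.reg .acc))) using 2
      · simp [tail_replicate_append (Nat.sub_pos_of_lt hi), Nat.sub_sub]
      · simp [List.replicate_succ]
      · simp [add_assoc])
    (by simpa [contents] using hw)
  simp only [Nat.sub_zero, Nat.sub_self, List.replicate_zero, List.nil_append, ← hm, Nat.add_zero,
    update_eq_self] at h
  exact h.mono (by omega)

theorem within_dropOnes (m : Mem) (n : ℕ) {w : List Bool} (hw : w.head? ≠ some true)
    (hm : m.heap = List.replicate n true ++ w) :
    Within dropOnes m (2 * n + 1) { m with heap := w } := by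
  have h := within_while (k := .heap) (c := (· == some true)) (p := pop .heap)
    (fun i => { m with heap := List.replicate (n - i) true ++ w }) n 1
    (fun i hi => by simp [contents, head?_replicate_append (Nat.sub_pos_of_lt hi)])
    (fun i hi => by
      convert within_pop_heap _ using 2
      simp [tail_replicate_append (Nat.sub_pos_of_lt hi), Nat.sub_sub])
    (by simpa [contents] using hw)
  simp only [Nat.sub_zero, Nat.sub_self, List.replicate_zero, List.nil_append, ← hm] at h
  exact h.mono (by omega)

theorem within_writeOnes (m : Mem) :
    Within writeOnes m (4 * m.cnt (.reg .acc) + 1)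
      { m with heap := List.replicate (m.cnt (.reg .acc)) true ++ m.heap,
               cnt := update (update m.cnt (.reg .acc) 0) .aux
                (m.cnt .aux + m.cnt (.reg .acc)) } := by
  have hc : Counter.reg .acc ≠ .aux := by simp
  have h := within_while (k := .cnt (.reg .acc)) (c := Option.isSome)
    (p := pop (.cnt (.reg .acc)) ;; push .heap true ;; push (.cnt .aux) true)
    (fun i => { m with
      heap := List.replicate i true ++ m.heap,
      cnt := update (update m.cnt (.reg .acc) (m.cnt (.reg .acc) - i)) .aux (m.cnt .aux + i) })
    (m.cnt (.reg .acc)) 3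
    (fun i hi => by simp [contents, isSome_head?_replicate]; omega)
    (fun i hi => by
      convert (within_pop_cnt _ (.reg .acc)).seq ((within_push_heap _ true).seq
        (within_push_cnt _ .aux)) using 2
      · simp [List.replicate_succ]
      · simp only [update_of_ne hc, update_of_ne hc.symm, update_self, update_comm hc.symm,
          update_idem]
        simp [Nat.sub_sub, add_assoc, update_comm hc])
    (by simp [contents])
  simp only [Nat.sub_zero, Nat.sub_self, List.replicate_zero, List.nil_append, Nat.add_zero,
    update_eq_self] at h
  exact h.mono (by omega)

theorem within_rewind (m : Mem) :
    Within rewind m (4 * m.back.length + 1)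
      { m with heap := m.back.reverse ++ m.heap, back := [] } := by
  have h := within_while (k := .back) (c := Option.isSome)
    (p := ite .back (· == some true) (pop .back ;; push .heap true) (pop .back ;; push .heap false))
    (fun i => { m with
      heap := (m.back.take i).reverse ++ m.heap, back := m.back.drop i }) m.back.length 3
    (fun i hi => by simp [contents, hi])
    (fun i hi => by
      have e : m.back.drop i = m.back[i] :: m.back.drop (i + 1) := List.drop_eq_getElem_cons hi
      have e' : m.back.take (i + 1) = m.back.take i ++ [m.back[i]] := by simp
      cases hb : m.back[i] with
      | true =>
        obtain ⟨t, ht, he⟩ := (within_pop_back { m with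
          heap := (m.back.take i).reverse ++ m.heap, back := m.back.drop i }).seq
          (within_push_heap _ true)
        refine ⟨1 + t, by omega, .ite_true (by simp [contents, e, hb]) ?_⟩
        convert he using 3
        · simp [e', hb]
        · simp
      | false =>
        obtain ⟨t, ht, he⟩ := (within_pop_back { m with
          heap := (m.back.take i).reverse ++ m.heap, back := m.back.drop i }).seq
          (within_push_heap _ false)
        refine ⟨1 + t, by omega, .ite_false (by simp [contents, e, hb]) ?_⟩
        convert he using 3
        · simp [e', hb]
        · simp)
    (by simp [contents])
  simp only [List.take_zero, List.reverse_nil, List.nil_append, List.drop_zero, List.take_length,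
    List.drop_length] at h
  exact h.mono (by omega)

end StackProg

/-! ### Memory access: lists of numbers in unary, padded with zeros. -/

namespace DFAInput

theorem unaryCode_nil : unaryCode [] = [] :=
  rfl

theorem unaryCode_cons (n : ℕ) (l : List ℕ) :
    unaryCode (n :: l) = List.replicate n true ++ false :: unaryCode l := by
  simp [unaryCode]

theorem unaryCode_append (l l' : List ℕ) : unaryCode (l ++ l') = unaryCode l ++ unaryCode l' := by
  simp [unaryCode]

theorem length_unaryCode_le {l : List ℕ} {V : ℕ} (h : ∀ n ∈ l, n ≤ V) :
    (unaryCode l).length ≤ l.length * (V + 1) := by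
  induction l with
  | nil => simp [unaryCode]
  | cons n l ih =>
    have h₁ := ih fun k hk => h k (List.mem_cons_of_mem _ hk)
    have h₂ := h n List.mem_cons_self
    simp only [unaryCode_cons, List.length_append, List.length_replicate, List.length_cons,
      Nat.add_mul]
    omega

theorem length_le_length_unaryCode (l : List ℕ) : l.length ≤ (unaryCode l).length := by
  induction l with
  | nil => simp
  | cons n l ih =>
    simp only [unaryCode_cons, List.length_append, List.length_replicate, List.length_cons]
    omega

theorem le_length_unaryCode {l : List ℕ} {n : ℕ} (h : n ∈ l) : n ≤ (unaryCode l).length := by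
  induction l with
  | nil => simp at h
  | cons k l ih =>
    simp only [unaryCode_cons, List.length_append, List.length_replicate, List.length_cons]
    rcases List.mem_cons.1 h with rfl | h
    · omega
    · have := ih h
      omega

/-- A uniform description of the cell `i`, whether or not the list is that long. Behind the end `w`
is empty: the cell reads as zero, and removing its missing delimiter changes nothing. -/
theorem unaryCode_drop (l : List ℕ) (i : ℕ) :
    ∃ w, unaryCode (l.drop i) = List.replicate (l.getD i 0) true ++ w ∧ w.head? ≠ some true ∧
      w.tail = unaryCode (l.drop (i + 1)) := by
  rcases Nat.lt_or_ge i l.length with h | h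
  · refine ⟨false :: unaryCode (l.drop (i + 1)), ?_, by simp, rfl⟩
    rw [List.drop_eq_getElem_cons h, unaryCode_cons, List.getD_eq_getElem _ _ h]
  · refine ⟨[], ?_, by simp, ?_⟩
    · rw [List.drop_eq_nil_of_le h, List.getD_eq_default _ _ h]
      rfl
    · rw [List.drop_eq_nil_of_le (by omega)]
      rfl

end DFAInput

namespace List

/-- The first `i` entries of a list of numbers, which is filled up with zeros. -/
def takePad (l : List ℕ) (i : ℕ) : List ℕ :=
  l.take i ++ replicate (i - l.length) 0

variable (l : List ℕ)

theorem length_takePad (i : ℕ) : (l.takePad i).length = i := by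
  simp only [takePad, length_append, length_take, length_replicate]
  omega

theorem takePad_zero : l.takePad 0 = [] := by
  simp [takePad]

theorem takePad_succ (i : ℕ) : l.takePad (i + 1) = l.takePad i ++ [l.getD i 0] := by
  unfold takePad
  rcases Nat.lt_or_ge i l.length with h | h
  · simp [Nat.sub_eq_zero_of_le h.le, Nat.sub_eq_zero_of_le h, h]
  · rw [getD_eq_default _ _ h, take_of_length_le h, take_of_length_le (by omega),
      Nat.sub_add_comm h, replicate_succ', append_assoc]

theorem getD_takePad {i j : ℕ} (h : j < i) : (l.takePad i).getD j 0 = l.getD j 0 := by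
  unfold takePad
  rcases Nat.lt_or_ge j l.length with hj | hj
  · rw [getD_append _ _ _ _ (by simp; omega)]
    simp [getD_eq_getElem?_getD, h]
  · rw [getD_eq_default _ _ hj, getD_append_right _ _ _ _ (by simp; omega)]
    simp [getD_eq_getElem?_getD, getElem?_replicate]
    split_ifs <;> rfl

theorem mem_takePad_le {V i : ℕ} (hl : ∀ n ∈ l, n ≤ V) : ∀ n ∈ l.takePad i, n ≤ V := by
  intro n hn
  rcases mem_append.1 hn with hn | hn
  · exact hl n (mem_of_mem_take hn)
  · rw [(mem_replicate.1 hn).2]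
    exact Nat.zero_le V

/-- Walking to an address behind the end of the list leaves new zero cells; the memory as a function
does not notice them. -/
theorem getD_takePad_append_drop (i j : ℕ) : (l.takePad i ++ l.drop i).getD j 0 = l.getD j 0 := by
  rcases Nat.lt_or_ge j i with h | h
  · rw [getD_append _ _ _ _ (by rwa [length_takePad]), getD_takePad l h]
  · rw [getD_append_right _ _ _ _ (by rwa [length_takePad]), length_takePad]
    simp [getD_eq_getElem?_getD, Nat.add_sub_cancel' h]

theorem getD_takePad_append_cons_drop (i j n : ℕ) :
    (l.takePad i ++ n :: l.drop (i + 1)).getD j 0 =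
      Function.update (fun j => l.getD j 0) i n j := by
  rcases lt_trichotomy j i with h | rfl | h
  · rw [getD_append _ _ _ _ (by rwa [length_takePad]), getD_takePad l h,
      Function.update_of_ne h.ne]
  · rw [getD_append_right _ _ _ _ (by rw [length_takePad]), length_takePad]
    simp
  · rw [getD_append_right _ _ _ _ (by rw [length_takePad]; omega), length_takePad,
      Function.update_of_ne h.ne']
    obtain ⟨k, rfl⟩ := Nat.exists_eq_add_of_lt h
    rw [show i + k + 1 - i = k + 1 by omega, getD_cons_succ]
    simp [getD_eq_getElem?_getD, add_right_comm]

end List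

namespace StackProg

open Function Mem DFAInput

theorem getD_le {l : List ℕ} {V : ℕ} (hl : ∀ n ∈ l, n ≤ V) (i : ℕ) : l.getD i 0 ≤ V := by
  rcases Nat.lt_or_ge i l.length with h | h
  · rw [List.getD_eq_getElem _ _ h]
    exact hl _ (List.getElem_mem h)
  · rw [List.getD_eq_default _ _ h]
    exact Nat.zero_le V

/-- Behind the end of the list, `pop .heap` has no effect while `push .back false` creates a zero
cell; this is why `takePad` appears. The address survives in `tmp`. -/
theorem within_seek (m : Mem) {l : List ℕ} {V : ℕ} (hm : m.heap = unaryCode l)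
    (hl : ∀ n ∈ l, n ≤ V) :
    Within seek m (m.cnt (.reg .addr) * (3 * V + 6) + 1)
      { m with
        heap := unaryCode (l.drop (m.cnt (.reg .addr))),
        back := (unaryCode (l.takePad (m.cnt (.reg .addr)))).reverse ++ m.back,
        cnt := update (update m.cnt (.reg .addr) 0) .tmp (m.cnt .tmp + m.cnt (.reg .addr)) } := by
  have hc : Counter.reg .addr ≠ .tmp := by simp
  let μ : ℕ → Mem := fun i => { m with
    heap := unaryCode (l.drop i),
    back := (unaryCode (l.takePad i)).reverse ++ m.back,
    cnt := update (update m.cnt (.reg .addr) (m.cnt (.reg .addr) - i)) .tmp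
      (m.cnt .tmp + i) }
  have h := within_while (k := .cnt (.reg .addr)) (c := Option.isSome)
    (p := pop (.cnt (.reg .addr)) ;; push (.cnt .tmp) true ;; skipOnes ;; pop .heap ;;
      push .back false) μ
    (m.cnt (.reg .addr)) (3 * V + 5)
    (fun i hi => by simp [μ, contents, isSome_head?_replicate]; omega)
    (fun i hi => by
      obtain ⟨w, hw, hw', hw''⟩ := unaryCode_drop l i
      have hV := getD_le hl i
      refine Within.mono (T := 1 + (1 + ((3 * l.getD i 0 + 1) + (1 + 1)))) ?_ (by omega)
      convert (within_pop_cnt (μ i) (.reg .addr)).seq ((within_push_cnt _ .tmp).seq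
        ((within_skipOnes _ (l.getD i 0) hw' hw).seq
          ((within_pop_heap _).seq (within_push_back _ false)))) using 2
      · rw [hw'']
      · simp [μ, List.takePad_succ, unaryCode_append, unaryCode_cons, unaryCode_nil]
      · simp only [μ, update_of_ne hc, update_of_ne hc.symm, update_self, update_comm hc.symm,
          update_idem]
        simp [Nat.sub_sub, add_assoc, update_comm hc])
    (by simp [μ, contents])
  simp only [μ, Nat.sub_zero, update_eq_self, Nat.sub_self, Nat.add_zero, List.drop_zero, ← hm,
    List.takePad_zero, unaryCode_nil, List.reverse_nil, List.nil_append] at h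
  exact h

/-- Reads the memory cell with address `addr` into `acc`. -/
def load : StackProg Stk :=
  clear (.reg .acc) ;; seek ;; readOnes ;; rewind ;; move .tmp (.reg .addr)

/-- Writes the value of `acc` into the memory cell with address `addr`. -/
def store : StackProg Stk :=
  -- Removing the delimiter and writing it anew creates it in case the cell lies behind the end of
  -- the memory.
  seek ;; dropOnes ;; pop .heap ;; push .heap false ;; writeOnes ;; rewind ;;
    move .tmp (.reg .addr) ;; move .aux (.reg .acc)

/-- At most `V` cells, each of length at most `V + 1`, are passed on the way to the address and
back, which gives the quadratic bound. -/
theorem within_load (m : Mem) {l : List ℕ} {V : ℕ} (hm : m.heap = unaryCode l)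
    (hl : ∀ n ∈ l, n ≤ V) (hb : m.back = []) (ht : m.cnt .tmp = 0)
    (ha : m.cnt (.reg .addr) ≤ V) (hv : m.cnt (.reg .acc) ≤ V) :
    Within load m (40 * (V + 1) ^ 2)
      { m with
        heap := unaryCode (l.takePad (m.cnt (.reg .addr)) ++ l.drop (m.cnt (.reg .addr)))
        cnt := update m.cnt (.reg .acc) (l.getD (m.cnt (.reg .addr)) 0) } := by
  obtain ⟨_, _, s, C⟩ := m
  dsimp only at *
  subst hm hb
  obtain ⟨a, ha'⟩ : ∃ a, C (.reg .addr) = a := ⟨_, rfl⟩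
  obtain ⟨w, hw, hw', -⟩ := unaryCode_drop l a
  have hV := getD_le hl a
  have hU := length_unaryCode_le (l.mem_takePad_le hl (i := a))
  rw [List.length_takePad] at hU
  obtain ⟨n, hn⟩ : ∃ n, l.getD a 0 = n := ⟨_, rfl⟩
  rw [hn] at hw hV
  rw [ha'] at ha ⊢
  have h₁ := within_clear ⟨unaryCode l, [], s, C⟩ (.reg .acc)
  have h₂ := within_seek ⟨unaryCode l, [], s, update C (.reg .acc) 0⟩ rfl hl
  simp only [update_of_ne (show Counter.reg .addr ≠ .reg .acc by simp), ha', ht, Nat.zero_add,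
    update_of_ne (show Counter.tmp ≠ .reg .acc by simp), List.append_nil] at h₂
  have h₃ := within_readOnes ⟨unaryCode (l.drop a), (unaryCode (l.takePad a)).reverse, s, update
    (update (update C (.reg .acc) 0) (.reg .addr) 0) .tmp a⟩ n hw' hw
  have h₄ := within_rewind ⟨w, List.replicate n true ++ (unaryCode (l.takePad a)).reverse, s, update
    (update (update (update C (.reg .acc) 0) (.reg .addr) 0) .tmp a) (.reg .acc) n⟩
  have h₅ := within_move ⟨unaryCode (l.takePad a) ++ (List.replicate n true ++ w), [], s, update
    (update (update (update C (.reg .acc) 0) (.reg .addr) 0) .tmp a) (.reg .acc) n⟩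
    (c := .tmp) (c' := .reg .addr) (by simp)
  simp at h₃ h₄ h₅
  have h₆ : Within load _ _ _ := h₁.seq (h₂.seq (h₃.seq (h₄.seq h₅)))
  convert h₆.mono (T' := 40 * (V + 1) ^ 2) _ using 2
  · rw [unaryCode_append, hw]
  · funext d
    by_cases d₁ : d = .reg .acc
    · subst d₁; simp [hn, -List.getD_eq_getElem?_getD]
    by_cases d₂ : d = .reg .addr
    · subst d₂; simp [ha']
    by_cases d₃ : d = .tmp
    · subst d₃; simp [ht]
    simp [d₁, d₂, d₃]
  · dsimp only
    nlinarith [Nat.mul_le_mul_right (V + 1) ha, Nat.mul_le_mul_right (3 * V + 6) ha]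

theorem within_store (m : Mem) {l : List ℕ} {V : ℕ} (hm : m.heap = unaryCode l)
    (hl : ∀ n ∈ l, n ≤ V) (hb : m.back = []) (ht : m.cnt .tmp = 0) (hx : m.cnt .aux = 0)
    (ha : m.cnt (.reg .addr) ≤ V) (hv : m.cnt (.reg .acc) ≤ V) :
    Within store m (40 * (V + 1) ^ 2)
      { m with
        heap := unaryCode (l.takePad (m.cnt (.reg .addr)) ++
          m.cnt (.reg .acc) :: l.drop (m.cnt (.reg .addr) + 1)) } := by
  obtain ⟨_, _, s, C⟩ := m
  dsimp only at *
  subst hm hb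
  obtain ⟨a, ha'⟩ : ∃ a, C (.reg .addr) = a := ⟨_, rfl⟩
  obtain ⟨v, hv'⟩ : ∃ v, C (.reg .acc) = v := ⟨_, rfl⟩
  obtain ⟨w, hw, hw', hw''⟩ := unaryCode_drop l a
  have hV := getD_le hl a
  have hU := length_unaryCode_le (l.mem_takePad_le hl (i := a))
  rw [List.length_takePad] at hU
  obtain ⟨n, hn⟩ : ∃ n, l.getD a 0 = n := ⟨_, rfl⟩
  rw [hn] at hw hV
  rw [ha'] at ha ⊢
  rw [hv'] at hv ⊢
  have h₁ := within_seek ⟨unaryCode l, [], s, C⟩ rfl hl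
  simp only [ha', ht, Nat.zero_add, List.append_nil] at h₁
  have h₂ := within_dropOnes ⟨unaryCode (l.drop a), (unaryCode (l.takePad a)).reverse, s, update
    (update C (.reg .addr) 0) .tmp a⟩ n hw' hw
  have h₃ := within_pop_heap ⟨w, (unaryCode (l.takePad a)).reverse, s, update
    (update C (.reg .addr) 0) .tmp a⟩
  rw [hw''] at h₃
  have h₄ := within_push_heap ⟨unaryCode (l.drop (a + 1)), (unaryCode (l.takePad a)).reverse, s,
    update (update C (.reg .addr) 0) .tmp a⟩ false
  have h₅ := within_writeOnes ⟨false :: unaryCode (l.drop (a + 1)),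
    (unaryCode (l.takePad a)).reverse, s, update (update C (.reg .addr) 0) .tmp a⟩
  simp [hv', hx] at h₅
  have h₆ := within_rewind ⟨List.replicate v true ++ false :: unaryCode (l.drop (a + 1)),
    (unaryCode (l.takePad a)).reverse, s, update (update (update (update C (.reg .addr) 0) .tmp a)
      (.reg .acc) 0) .aux v⟩
  simp at h₆
  have h₇ := within_move ⟨unaryCode (l.takePad a) ++ (List.replicate v true ++
    false :: unaryCode (l.drop (a + 1))), [], s, update (update (update (update C (.reg .addr) 0)
      .tmp a) (.reg .acc) 0) .aux v⟩ (c := .tmp) (c' := .reg .addr) (by simp)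
  simp at h₇
  have h₈ := within_move ⟨unaryCode (l.takePad a) ++ (List.replicate v true ++
    false :: unaryCode (l.drop (a + 1))), [], s, update (update (update (update (update (update C
      (.reg .addr) 0) .tmp a) (.reg .acc) 0) .aux v) .tmp 0) (.reg .addr) a⟩
    (c := .aux) (c' := .reg .acc) (by simp)
  simp at h₈
  have h₉ : Within store _ _ _ := h₁.seq (h₂.seq (h₃.seq (h₄.seq (h₅.seq (h₆.seq (h₇.seq h₈))))))
  convert h₉.mono (T' := 40 * (V + 1) ^ 2) _ using 2
  · rw [unaryCode_append, unaryCode_cons]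
  · funext d
    by_cases d₁ : d = .reg .acc
    · subst d₁; simp [hv']
    by_cases d₂ : d = .reg .addr
    · subst d₂; simp [ha']
    by_cases d₃ : d = .tmp
    · subst d₃; simp [ht]
    by_cases d₄ : d = .aux
    · subst d₄; simp [hx]
    simp [d₁, d₂, d₃, d₄]
  · nlinarith [Nat.mul_le_mul_right (V + 1) ha, Nat.mul_le_mul_right (3 * V + 6) ha]

end StackProg

/-! ### The register language and its simulation by stack programs. -/

/-- Commands of a register machine with memory. A loop is repeated as often as one of two
parameters says; there is no other form of repetition. -/
inductive Cmd : Type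
  | skip
  | seq (c d : Cmd)
  | inc (r : Reg)
  | dec (r : Reg)
  | clr (r : Reg)
  | cpy (r s : Reg)
  | load
  | store
  | ifz (r : Reg) (c d : Cmd)
  | loop (b : Bool) (c : Cmd)

/-- The registers and the memory. -/
structure RegMem : Type where
  reg : Reg → ℕ
  mem : ℕ → ℕ

namespace Cmd

open Function

infixr:60 " ;; " => Cmd.seq

/-- The effect of a command, where `par` gives the two parameters. -/
def run (par : Bool → ℕ) : Cmd → RegMem → RegMem
  | skip, s => s
  | seq c d, s => run par d (run par c s)
  | inc r, s => { s with reg := update s.reg r (s.reg r + 1) }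
  | dec r, s => { s with reg := update s.reg r (s.reg r - 1) }
  | clr r, s => { s with reg := update s.reg r 0 }
  | cpy r r', s => { s with reg := update s.reg r (s.reg r') }
  | load, s => { s with reg := update s.reg .acc (s.mem (s.reg .addr)) }
  | store, s => { s with mem := update s.mem (s.reg .addr) (s.reg .acc) }
  | ifz r c d, s => if s.reg r = 0 then run par c s else run par d s
  | loop b c, s => (run par c)^[par b] s

/-- A bound for the number of instructions that are executed. -/
def cost (par : Bool → ℕ) : Cmd → ℕ
  | seq c d => cost par c + cost par d
  | ifz _ c d => 1 + cost par c + cost par d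
  | loop b c => 1 + par b * (cost par c + 1)
  | _ => 1

/-- The number of rounds of a loop is a parameter that no command can change, so nesting of loops
only multiplies polynomials. -/
theorem exists_polynomial_cost_le (c : Cmd) :
    ∃ p : Polynomial ℕ, ∀ (par : Bool → ℕ) (n : ℕ), (∀ b, par b ≤ n) → c.cost par ≤ p.eval n := by
  induction c with
  | seq c d ihc ihd =>
    obtain ⟨p, hp⟩ := ihc
    obtain ⟨q, hq⟩ := ihd
    refine ⟨p + q, fun par n h => ?_⟩
    simpa [cost] using Nat.add_le_add (hp par n h) (hq par n h)
  | ifz r c d ihc ihd =>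
    obtain ⟨p, hp⟩ := ihc
    obtain ⟨q, hq⟩ := ihd
    refine ⟨1 + p + q, fun par n h => ?_⟩
    have := hp par n h
    have := hq par n h
    simp [cost]
    omega
  | loop b c ih =>
    obtain ⟨p, hp⟩ := ih
    refine ⟨1 + Polynomial.X * (p + 1), fun par n h => ?_⟩
    simpa [cost] using Nat.mul_le_mul (h b) (Nat.succ_le_succ (hp par n h))
  | _ => exact ⟨1, fun par n _ => by simp [cost]⟩

/-- Pushes as many ones as the value of a parameter, and adds this value to `tmp`. -/
def pushLoop (b : Bool) : StackProg Stk :=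
  StackProg.while (.cnt (.par b)) Option.isSome
    (.seq (.pop (.cnt (.par b))) (.seq (.push (.cnt .tmp) true) (.push .loops true)))

/-- The translation into a program over stacks. -/
def compile : Cmd → StackProg Stk
  | skip => .skip
  | seq c d => .seq (compile c) (compile d)
  | inc r => .push (.cnt (.reg r)) true
  | dec r => .pop (.cnt (.reg r))
  | clr r => .clear (.reg r)
  | cpy r s => if r = s then .skip else
      .seq (.clear (.reg r)) (.seq (.move (.reg s) .tmp) (.moveBoth .tmp (.reg s) (.reg r)))
  | load => .load
  | store => .store
  | ifz r c d => .ite (.cnt (.reg r)) Option.isNone (compile c) (compile d)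
  | loop b c =>
    -- The `false` separates the pending rounds of this loop from those of the enclosing loops. The
    -- parameter is restored before the body runs, since an inner loop may use it again.
    .seq (.push .loops false) (.seq (pushLoop b) (.seq (.move .tmp (.par b))
      (.seq (.while .loops (· == some true) (.seq (.pop .loops) (compile c))) (.pop .loops))))

end Cmd

/-- The stacks represent the registers and the memory, where all numbers and addresses in use
are at most `M`. -/
structure Mem.Represents (par : Bool → ℕ) (M : ℕ) (s : RegMem) (m : Mem) : Prop where
  back : m.back = []
  tmp : m.cnt .tmp = 0
  aux : m.cnt .aux = 0
  cnt_par : ∀ b, m.cnt (.par b) = par b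
  par_le : ∀ b, par b ≤ M
  reg : ∀ r, m.cnt (.reg r) = s.reg r
  reg_le : ∀ r, s.reg r ≤ M
  heap : ∃ l : List ℕ, m.heap = DFAInput.unaryCode l ∧ l.length ≤ M ∧ (∀ n ∈ l, n ≤ M) ∧
    ∀ i, l.getD i 0 = s.mem i

namespace Mem.Represents

open Function

variable {par : Bool → ℕ} {M N : ℕ} {s : RegMem} {m : Mem}

theorem mono (h : m.Represents par M s) (hMN : M ≤ N) : m.Represents par N s where
  __ := h
  par_le b := (h.par_le b).trans hMN
  reg_le r := (h.reg_le r).trans hMN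
  heap :=
    let ⟨l, hl, h₁, h₂, h₃⟩ := h.heap
    ⟨l, hl, h₁.trans hMN, fun n hn => (h₂ n hn).trans hMN, h₃⟩

theorem setLoops (h : m.Represents par M s) (L : List Bool) :
    Mem.Represents par M s { m with loops := L } where
  __ := h

theorem setReg (h : m.Represents par M s) (r : Reg) {n : ℕ} (hn : n ≤ M) :
    Mem.Represents par M { s with reg := update s.reg r n }
      { m with cnt := update m.cnt (.reg r) n } where
  __ := h
  tmp := by simpa using h.tmp
  aux := by simpa using h.aux
  cnt_par := by simpa using h.cnt_par
  reg r' := by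
    by_cases hr : r' = r
    · subst hr; simp
    · simpa [hr] using h.reg r'
  reg_le r' := by
    by_cases hr : r' = r
    · subst hr; simpa
    · simpa [hr] using h.reg_le r'

end Mem.Represents

namespace Cmd

open Function StackProg Mem

/-- `compile c` simulates `c`, where each instruction takes at most `40 * (W + 1) ^ 2` steps
as long as all numbers are at most `W`. -/
def Simulated (par : Bool → ℕ) (W : ℕ) (c : Cmd) : Prop :=
  ∀ (M : ℕ) (s : RegMem) (m : Mem), m.Represents par M s → M + c.cost par ≤ W →
    ∃ m' : Mem, m'.Represents par (M + c.cost par) (c.run par s) ∧ m'.loops = m.loops ∧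
      Within c.compile m (c.cost par * (40 * (W + 1) ^ 2)) m'

variable {par : Bool → ℕ} {W : ℕ}

theorem le_stepBound (W : ℕ) : 40 * W + 40 ≤ 40 * (W + 1) ^ 2 := by
  nlinarith

theorem simulated_skip : Simulated par W skip := fun M s m h hW =>
  ⟨m, h.mono (Nat.le_add_right _ _), rfl, (within_skip m).mono (by
    have := le_stepBound W
    simp only [cost]
    omega)⟩

theorem simulated_inc (r : Reg) : Simulated par W (inc r) := fun M s m h hW => by
  have := le_stepBound W
  refine ⟨_, (h.mono (Nat.le_succ M)).setReg r (n := s.reg r + 1)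
    (Nat.succ_le_succ (h.reg_le r)), rfl, ?_⟩
  rw [← h.reg r]
  refine (within_push_cnt m (.reg r)).mono ?_
  simp only [cost]
  omega

theorem simulated_dec (r : Reg) : Simulated par W (dec r) := fun M s m h hW => by
  have := le_stepBound W
  refine ⟨_, (h.mono (Nat.le_succ M)).setReg r (n := s.reg r - 1)
    (by have := h.reg_le r; omega), rfl, ?_⟩
  rw [← h.reg r]
  refine (within_pop_cnt m (.reg r)).mono ?_
  simp only [cost]
  omega

theorem simulated_clr (r : Reg) : Simulated par W (clr r) := fun M s m h hW => by
  have := le_stepBound W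
  have := h.reg_le r
  refine ⟨_, (h.mono (Nat.le_succ M)).setReg r (n := 0) (Nat.zero_le _), rfl,
    (within_clear m (.reg r)).mono ?_⟩
  simp only [cost, h.reg] at *
  omega

theorem simulated_cpy (r r' : Reg) : Simulated par W (cpy r r') := fun M s m h hW => by
  have := le_stepBound W
  have := h.reg_le r
  have := h.reg_le r'
  by_cases hr : r = r'
  · subst hr
    refine ⟨m, ?_, rfl, ?_⟩
    · simpa [run, cost] using h.mono (Nat.le_succ M)
    · simp only [compile, if_pos]
      refine (within_skip m).mono ?_
      simp only [cost]
      omega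
  · refine ⟨_, (h.mono (Nat.le_succ M)).setReg r (n := s.reg r') (by omega), rfl, ?_⟩
    have h₁ := within_clear m (.reg r)
    have h₂ := within_move { m with cnt := update m.cnt (.reg r) 0 } (c := .reg r') (c' := .tmp)
      (by simp)
    simp [Ne.symm hr, h.tmp] at h₂
    have h₃ := within_moveBoth { m with
      cnt := update (update (update m.cnt (.reg r) 0) (.reg r') 0) .tmp (m.cnt (.reg r')) }
      (c := .tmp) (c' := .reg r') (c'' := .reg r) (by simp) (by simp) (by simp [Ne.symm hr])
    simp [hr] at h₃
    have h₄ := h₁.seq (h₂.seq h₃)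
    simp only [compile, if_neg hr]
    convert h₄.mono _ using 2
    · funext d
      by_cases d₁ : d = .reg r
      · subst d₁; simp [h.reg]
      by_cases d₂ : d = .reg r'
      · subst d₂; simp [Ne.symm hr]
      by_cases d₃ : d = .tmp
      · subst d₃; simp [h.tmp]
      simp [d₁, d₂, d₃]
    · simp only [cost, h.reg] at *
      omega

/-- A zero-padded list has length at most the maximum of its old length and the address, so it stays
within the bound. -/
theorem simulated_load : Simulated par W load := fun M s m h hW => by
  obtain ⟨l, h₁, h₂, h₃, h₄⟩ := h.heap
  have ha := h.reg_le .addr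
  refine ⟨_, ?_, ?_, (within_load m h₁ h₃ h.back h.tmp (h.reg .addr ▸ ha)
    (h.reg .acc ▸ h.reg_le .acc)).mono ?_⟩
  · have hn : l.getD (m.cnt (.reg .addr)) 0 = s.mem (s.reg .addr) := by rw [h₄, h.reg]
    have h₅ := (h.mono (Nat.le_succ M)).setReg .acc (n := s.mem (s.reg .addr))
      (by rw [← hn]; exact (getD_le h₃ _).trans (Nat.le_succ M))
    rw [hn]
    exact { h₅ with
      heap := by
        refine ⟨_, rfl, ?_, ?_, fun i => ?_⟩
        · simp only [List.length_append, List.length_takePad, List.length_drop, h.reg, cost]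
          omega
        · intro n hn'
          rcases List.mem_append.1 hn' with hn' | hn'
          · exact (l.mem_takePad_le h₃ n hn').trans (Nat.le_succ M)
          · exact (h₃ n (List.mem_of_mem_drop hn')).trans (Nat.le_succ M)
        · rw [List.getD_takePad_append_drop, h₄]
          rfl }
  · rfl
  · simp only [cost, Nat.one_mul] at *
    gcongr
    omega

/-- Writing at the address `a` may lengthen the list to `a + 1` entries; this is where the increase
of the bound by one is used. -/
theorem simulated_store : Simulated par W store := fun M s m h hW => by
  obtain ⟨l, h₁, h₂, h₃, h₄⟩ := h.heap
  have ha := h.reg_le .addr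
  have hv := h.reg_le .acc
  refine ⟨_, ?_, ?_, (within_store m h₁ h₃ h.back h.tmp h.aux (h.reg .addr ▸ ha)
    (h.reg .acc ▸ hv)).mono ?_⟩
  · exact { h.mono (Nat.le_succ M) with
      heap := by
        refine ⟨_, rfl, ?_, ?_, fun i => ?_⟩
        · simp only [List.length_append, List.length_takePad, List.length_cons, List.length_drop,
            h.reg, cost]
          omega
        · intro n hn'
          rcases List.mem_append.1 hn' with hn' | hn'
          · exact (l.mem_takePad_le h₃ n hn').trans (Nat.le_succ M)
          rcases List.mem_cons.1 hn' with rfl | hn'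
          · rw [h.reg]
            exact hv.trans (Nat.le_succ M)
          · exact (h₃ n (List.mem_of_mem_drop hn')).trans (Nat.le_succ M)
        · rw [List.getD_takePad_append_cons_drop, h.reg, h.reg]
          simp only [run, h₄] }
  · rfl
  · simp only [cost, Nat.one_mul] at *
    gcongr
    omega

theorem Simulated.seq {c d : Cmd} (hc : Simulated par W c) (hd : Simulated par W d) :
    Simulated par W (c ;; d) := fun M s m h hW => by
  simp only [cost] at hW ⊢
  obtain ⟨m₁, h₁, h₂, h₃⟩ := hc M s m h (by omega)
  obtain ⟨m₂, h₄, h₅, h₆⟩ := hd _ _ m₁ h₁ (by omega)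
  exact ⟨m₂, h₄.mono (by omega), h₅.trans h₂, (h₃.seq h₆).mono (Nat.add_mul _ _ _).ge⟩

theorem Simulated.ifz {c d : Cmd} (hc : Simulated par W c) (hd : Simulated par W d) (r : Reg) :
    Simulated par W (ifz r c d) := fun M s m h hW => by
  have hB := le_stepBound W
  simp only [cost] at hW ⊢
  by_cases hr : s.reg r = 0
  · obtain ⟨m₁, h₁, h₂, t, ht, he⟩ := hc M s m h (by omega)
    refine ⟨m₁, ?_, h₂, 1 + t, ?_, .ite_true ?_ he⟩
    · simpa [run, hr] using h₁.mono (by omega)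
    · rw [Nat.add_mul, Nat.add_mul]
      omega
    · simp [contents, h.reg, hr]
  · obtain ⟨m₁, h₁, h₂, t, ht, he⟩ := hd M s m h (by omega)
    refine ⟨m₁, ?_, h₂, 1 + t, ?_, .ite_false ?_ he⟩
    · simpa [run, hr] using h₁.mono (by omega)
    · rw [Nat.add_mul, Nat.add_mul]
      omega
    · obtain ⟨n, hn⟩ := Nat.exists_eq_succ_of_ne_zero hr
      simp [contents, h.reg, hn, List.replicate_succ]

theorem within_pushLoop (m : Mem) (b : Bool) :
    Within (pushLoop b) m (4 * m.cnt (.par b) + 1)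
      { m with
        loops := List.replicate (m.cnt (.par b)) true ++ m.loops
        cnt := update (update m.cnt (.par b) 0) .tmp (m.cnt .tmp + m.cnt (.par b)) } := by
  have hc : Counter.par b ≠ .tmp := by simp
  have h := within_while (k := .cnt (.par b)) (c := Option.isSome)
    (p := .seq (pop (.cnt (.par b))) (.seq (push (.cnt .tmp) true) (push .loops true)))
    (fun i => { m with
      loops := List.replicate i true ++ m.loops,
      cnt := update (update m.cnt (.par b) (m.cnt (.par b) - i)) .tmp (m.cnt .tmp + i) })
    (m.cnt (.par b)) 3
    (fun i hi => by simp [contents, isSome_head?_replicate]; omega)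
    (fun i hi => by
      convert (within_pop_cnt _ (.par b)).seq ((within_push_cnt _ .tmp).seq
        (within_push_loops _ true)) using 2
      · simp [List.replicate_succ]
      · simp only [update_of_ne hc, update_of_ne hc.symm, update_self, update_comm hc.symm,
          update_idem]
        simp [Nat.sub_sub, add_assoc, update_comm hc])
    (by simp [contents])
  simp only [Nat.sub_zero, Nat.sub_self, List.replicate_zero, List.nil_append, Nat.add_zero,
    update_eq_self] at h
  exact h.mono (by omega)

/-- The ones above the topmost `false` count the remaining rounds. A simulated body returns the loop
stack as it found it, so nested loops do not interfere. The extra `1` in the cost of a round pays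
for its test and its pop. -/
theorem Simulated.iterate {c : Cmd} (hc : Simulated par W c) (j : ℕ) :
    ∀ (M : ℕ) (s : RegMem) (m : Mem) (L : List Bool), m.Represents par M s →
      m.loops = List.replicate j true ++ false :: L → M + j * (c.cost par + 1) ≤ W →
      ∃ m' : Mem, m'.Represents par (M + j * (c.cost par + 1)) ((c.run par)^[j] s) ∧
        m'.loops = false :: L ∧
        Within (StackProg.while .loops (· == some true) (.seq (pop .loops) c.compile)) m
          (j * (c.cost par + 1) * (40 * (W + 1) ^ 2) + 1) m' := by
  have hB := le_stepBound W
  unfold Simulated at hc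
  generalize 40 * (W + 1) ^ 2 = B at *
  induction j with
  | zero =>
    intro M s m L h hL hW
    refine ⟨m, by simpa using h, by simpa using hL, 1, by omega, .while_false ?_⟩
    simp [contents, hL]
  | succ j ih =>
    intro M s m L h hL hW
    rw [Nat.add_mul, Nat.one_mul] at hW ⊢
    have h₀ := within_pop_loops m
    obtain ⟨m₁, h₁, h₂, h₃⟩ := hc M s _ (h.setLoops m.loops.tail) (by omega)
    obtain ⟨m₂, h₄, h₅, t', ht', he'⟩ := ih _ _ m₁ L h₁
      (by simp [h₂, hL, List.replicate_succ]) (by omega)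
    obtain ⟨t, ht, he⟩ := h₀.seq h₃
    refine ⟨m₂, h₄.mono (by omega), h₅, 1 + t + t', ?_, .while_true ?_ he he'⟩
    · rw [Nat.add_mul _ _ B, Nat.add_mul _ 1 B]
      omega
    · simp [contents, hL, List.replicate_succ]

/-- The single instruction charged beyond the rounds pays for copying the parameter to the loop
stack and restoring it, which is linear in `W`. -/
theorem Simulated.loop {c : Cmd} (hc : Simulated par W c) (b : Bool) :
    Simulated par W (loop b c) := fun M s m h hW => by
  have hB := le_stepBound W
  simp only [cost] at hW ⊢
  have hp := h.par_le b
  have h₁ := within_push_loops m false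
  have h₂ := within_pushLoop { m with loops := false :: m.loops } b
  simp only [h.cnt_par, h.tmp, Nat.zero_add] at h₂
  have h₃ := within_move { m with
    loops := List.replicate (par b) true ++ false :: m.loops
    cnt := update (update m.cnt (.par b) 0) .tmp (par b) } (c := .tmp) (c' := .par b) (by simp)
  have e : update (update (update m.cnt (.par b) 0) .tmp 0) (.par b) (par b) = m.cnt := by
    funext d
    by_cases d₁ : d = .par b
    · subst d₁; simp [h.cnt_par]
    by_cases d₂ : d = .tmp
    · subst d₂; simp [h.tmp]
    simp [d₁, d₂]
  simp at h₃
  rw [e] at h₃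
  obtain ⟨m₁, h₄, h₅, h₆⟩ := hc.iterate (par b) (M + 1) s _ m.loops
    ((h.setLoops (List.replicate (par b) true ++ false :: m.loops)).mono (Nat.le_succ M)) rfl
    (by omega)
  refine ⟨_, (h₄.mono (by omega)).setLoops m₁.loops.tail, by simp [h₅],
    (h₁.seq (h₂.seq (h₃.seq (h₆.seq (within_pop_loops m₁))))).mono ?_⟩
  rw [Nat.add_mul, Nat.one_mul]
  omega

theorem simulated (par : Bool → ℕ) (W : ℕ) (c : Cmd) : Simulated par W c := by
  induction c with
  | skip => exact simulated_skip
  | seq c d hc hd => exact hc.seq hd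
  | inc r => exact simulated_inc r
  | dec r => exact simulated_dec r
  | clr r => exact simulated_clr r
  | cpy r r' => exact simulated_cpy r r'
  | load => exact simulated_load
  | store => exact simulated_store
  | ifz r c d hc hd => exact hc.ifz hd r
  | loop b c hc => exact hc.loop b

end Cmd

/-! ### Input and output: from commands to polynomial-time deciders. -/

namespace StackProg

open Function Mem

/-- Empties all stacks of a list of counters. -/
def clearList : List Counter → StackProg Stk
  | [] => skip
  | c :: l => clear c ;; clearList l

theorem within_clearList (l : List Counter) : ∀ (m : Mem) (V : ℕ), (∀ c, m.cnt c ≤ V) →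
    Within (clearList l) m (l.length * (2 * V + 1) + 1)
      { m with cnt := fun c => if c ∈ l then 0 else m.cnt c } := by
  induction l with
  | nil =>
    intro m V _
    have e : { m with cnt := fun c => if c ∈ [] then 0 else m.cnt c } = m := by simp
    rw [e]
    exact (within_skip m).mono (by omega)
  | cons c l ih =>
    intro m V hV
    have h₁ := within_clear m c
    have h₂ := ih { m with cnt := update m.cnt c 0 } V (fun d => by
      by_cases hd : d = c
      · subst hd; simp
      · simpa [hd] using hV d)
    have h₃ : Within (clearList (c :: l)) _ _ _ := h₁.seq h₂
    convert h₃.mono _ using 2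
    · funext d
      by_cases hd : d = c
      · subst hd; simp
      · simp [hd]
    · have := hV c
      simp only [List.length_cons, Nat.add_mul]
      omega

/-- Empties the memory. -/
def clearHeap : StackProg Stk :=
  StackProg.while .heap Option.isSome (pop .heap)

theorem within_clearHeap (m : Mem) :
    Within clearHeap m (2 * m.heap.length + 1) { m with heap := [] } := by
  have h := within_while (k := .heap) (c := Option.isSome) (p := pop .heap)
    (fun i => { m with heap := m.heap.drop i }) m.heap.length 1
    (fun i hi => by simp [contents, hi])
    (fun i hi => by
      convert within_pop_heap _ using 2
      simp) (by simp [contents])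
  simp only [List.drop_zero, List.drop_length] at h
  exact h.mono (by omega)

/-- Empties the memory, the parameters and the registers, and writes one symbol. -/
def output (b : Bool) : StackProg Stk :=
  clearHeap ;; clearList ([.par false, .par true] ++
    [Reg.addr, .acc, .a, .b, .c, .d, .e, .f].map Counter.reg) ;; push .heap b

/-- The output convention of the machine model requires all stacks except the output stack to be
empty. The stacks that are not cleared here are empty already. -/
theorem within_output {par : Bool → ℕ} {M : ℕ} {s : RegMem} {m : Mem}
    (h : m.Represents par M s) (hL : m.loops = []) (b : Bool) :
    Within (output b) m (40 * (M + 1) ^ 2) ⟨[b], [], [], fun _ => 0⟩ := by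
  obtain ⟨l, h₁, h₂, h₃, -⟩ := h.heap
  have hl : m.heap.length ≤ M * (M + 1) := by
    rw [h₁]
    exact (DFAInput.length_unaryCode_le h₃).trans (Nat.mul_le_mul_right _ h₂)
  have e₁ := within_clearHeap m
  have e₂ := within_clearList ([.par false, .par true] ++
    [Reg.addr, .acc, .a, .b, .c, .d, .e, .f].map Counter.reg) { m with heap := [] } M (fun c => by
      cases c with
      | tmp => simp [h.tmp]
      | aux => simp [h.aux]
      | par b => simpa [h.cnt_par] using h.par_le b
      | reg r => simpa [h.reg] using h.reg_le r)
  have e₃ := within_push_heap ⟨[], [], [], fun _ => 0⟩ b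
  have e : (Mem.mk [] m.back m.loops fun c => if c ∈ [Counter.par false, .par true] ++
      [Reg.addr, .acc, .a, .b, .c, .d, .e, .f].map Counter.reg then 0 else m.cnt c) =
      ⟨[], [], [], fun _ => 0⟩ := by
    rw [h.back, hL]
    congr 1
    funext c
    cases c with
    | tmp => simp [h.tmp]
    | aux => simp [h.aux]
    | par b => cases b <;> simp
    | reg r => cases r <;> simp
  dsimp only at e₂
  rw [e] at e₂
  refine (e₁.seq (e₂.seq e₃)).mono ?_
  simp only [List.length_append, List.length_map, List.length_cons, List.length_nil]
  nlinarith

end StackProg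

namespace Mem.Represents

open Function StackProg

/-- Commands cannot set parameters, so these are filled in by a stack program outside the command
language. As the parameter is zero before, adding `acc` to it sets it. -/
theorem moveAcc {par : Bool → ℕ} {M : ℕ} {s : RegMem} {m : Mem} (h : m.Represents par M s)
    (b : Bool) (hb : par b = 0) :
    ∃ m' : Mem, m'.Represents (update par b (s.reg .acc)) M { s with reg := update s.reg .acc 0 } ∧
      m'.loops = m.loops ∧ Within (move (.reg .acc) (.par b)) m (40 * (M + 1) ^ 2) m' := by
  have hM := h.reg_le .acc
  refine ⟨_, ?_, ?_, (within_move m (c := .reg .acc) (c' := .par b) (by simp)).mono ?_⟩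
  · exact { h with
      tmp := by simpa using h.tmp
      aux := by simpa using h.aux
      cnt_par := fun b' => by
        by_cases hb' : b' = b
        · subst hb'; simp [h.cnt_par, h.reg, hb]
        · simp [hb', h.cnt_par]
      par_le := fun b' => by
        by_cases hb' : b' = b
        · subst hb'; simpa using hM
        · simpa [hb'] using h.par_le b'
      reg := fun r => by
        by_cases hr : r = .acc
        · subst hr; simp
        · simp [hr, h.reg]
      reg_le := fun r => by
        by_cases hr : r = .acc
        · subst hr; simp
        · simpa [hr] using h.reg_le r }
  · rfl
  · rw [h.reg]
    nlinarith

end Mem.Represents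

namespace DFAInput

open Function StackProg Mem

/-- The two parameters of the register machine: the numbers of states and of letters. -/
def params (A : DFAInput) : Bool → ℕ :=
  fun b => bif b then A.letters else A.states

/-- The initial state of the register machine: all registers are zero and the memory holds
the numbers that describe the DFA. -/
noncomputable def init (A : DFAInput) : RegMem :=
  ⟨fun _ => 0, fun i => A.numbers.getD i 0⟩

/-- Reads the parameters, executes a command, and tests the register `acc`. -/
def decider (c : Cmd) : StackProg Stk :=
  .seq Cmd.load.compile (.seq (move (.reg .acc) (.par false))
    (.seq (Cmd.seq (.inc .addr) .load).compile (.seq (move (.reg .acc) (.par true))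
      (.seq (Cmd.seq (.dec .addr) c).compile
        (ite (.cnt (.reg .acc)) Option.isSome (output true) (output false))))))

theorem numbers_getD_two (A : DFAInput) : A.numbers.getD 2 0 = A.dfa.start := by
  simp [numbers]

/-- The four instructions around `c` (two loads, one increment, one decrement) account for the `4`.
Together with the two moves, the output and the final test they make up the `8`. -/
theorem within_decider (c : Cmd) (A : DFAInput) (W : ℕ)
    (hW : A.encode.length + 4 + c.cost A.params ≤ W) :
    Within (decider c) ⟨A.encode, [], [], fun _ => 0⟩ ((c.cost A.params + 8) * (40 * (W + 1) ^ 2))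
      ⟨[decide ((c.run A.params A.init).reg .acc ≠ 0)], [], [], fun _ => 0⟩ := by
  have hB := Cmd.le_stepBound W
  have hmono : ∀ M ≤ W, 40 * (M + 1) ^ 2 ≤ 40 * (W + 1) ^ 2 := fun M hM => by gcongr
  have h₀ : Mem.Represents (fun _ => 0) A.encode.length A.init
      ⟨A.encode, [], [], fun _ => 0⟩ :=
    { back := rfl
      tmp := rfl
      aux := rfl
      cnt_par := fun _ => rfl
      par_le := fun _ => Nat.zero_le _
      reg := fun _ => rfl
      reg_le := fun _ => Nat.zero_le _
      heap := ⟨A.numbers, rfl, length_le_length_unaryCode _, fun n => le_length_unaryCode,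
        fun _ => rfl⟩ }
  generalize A.encode.length = N at *
  obtain ⟨m₁, r₁, l₁, w₁⟩ := Cmd.simulated _ W .load _ _ _ h₀ (by simp only [Cmd.cost]; omega)
  obtain ⟨m₂, r₂, l₂, w₂⟩ := r₁.moveAcc false rfl
  obtain ⟨m₃, r₃, l₃, w₃⟩ := Cmd.simulated _ W (.seq (.inc .addr) .load) _ _ _ r₂
    (by simp only [Cmd.cost]; omega)
  obtain ⟨m₄, r₄, l₄, w₄⟩ := r₃.moveAcc true (by simp)
  have e : update (update (fun _ => 0) false ((Cmd.load.run (fun _ => 0) A.init).reg .acc)) true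
      (((Cmd.seq (.inc .addr) .load).run (update (fun _ => 0) false
        ((Cmd.load.run (fun _ => 0) A.init).reg .acc)) { Cmd.load.run (fun _ => 0) A.init with
          reg := update (Cmd.load.run (fun _ => 0) A.init).reg .acc 0 }).reg .acc) = A.params := by
    funext b
    cases b
    · simp [Cmd.run, init, params, numbers]
    · simp [Cmd.run, init, params, numbers]
  rw [e] at r₄
  obtain ⟨m₅, r₅, l₅, w₅⟩ := Cmd.simulated A.params W (.seq (.dec .addr) c) _ _ _ r₄
    (by simp only [Cmd.cost]; omega)
  -- After `dec .addr` all registers are zero again, so `c` starts in the initial state.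
  have e' : ∀ s : RegMem, s.reg .addr = 1 → (∀ r, r ≠ .addr → s.reg r = 0) →
      s.mem = A.init.mem → (Cmd.seq (.dec .addr) c).run A.params s = c.run A.params A.init := by
    rintro ⟨r, _⟩ h₁ h₂ rfl
    dsimp only at h₁ h₂
    have h₃ : update r .addr (r .addr - 1) = fun _ => 0 := by
      funext r'
      by_cases hr : r' = .addr
      · subst hr; simp [h₁]
      · simpa [hr] using h₂ r' hr
    simp only [Cmd.run, h₃]
    rfl
  rw [e' _ (by simp [Cmd.run, init]) (fun r hr => by cases r <;> simp_all [Cmd.run, init])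
    (by simp [Cmd.run])] at r₅
  have hL : m₅.loops = [] := by rw [l₅, l₄, l₃, l₂, l₁]
  have w₆ := within_output r₅ hL (decide ((c.run A.params A.init).reg .acc ≠ 0))
  have w₇ : Within (ite (.cnt (.reg .acc)) Option.isSome (output true) (output false)) m₅
      (1 + 40 * (W + 1) ^ 2) ⟨[decide ((c.run A.params A.init).reg .acc ≠ 0)], [], [],
        fun _ => 0⟩ := by
    obtain ⟨t, ht, he⟩ := w₆.mono (hmono _ (by simp only [Cmd.cost]; omega))
    refine ⟨1 + t, by omega, ?_⟩
    have hs : ((m₅.contents (.cnt (.reg .acc))).head?.isSome) =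
        decide ((c.run A.params A.init).reg .acc ≠ 0) := by
      simp only [contents, isSome_head?_replicate, r₅.reg]
    cases hd : decide ((c.run A.params A.init).reg .acc ≠ 0) with
    | true => exact .ite_true (hs.trans hd) (hd ▸ he)
    | false => exact .ite_false (hs.trans hd) (hd ▸ he)
  refine (w₁.seq ((w₂.mono (hmono _ ?_)).seq (w₃.seq ((w₄.mono (hmono _ ?_)).seq
    (w₅.seq w₇))))).mono ?_
  · simp only [Cmd.cost]; omega
  · simp only [Cmd.cost]; omega
  · simp only [Cmd.cost, Nat.add_mul]
    omega

/-- A property of DFAs that is decided by a command of the register machine is decidable in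
polynomial time. -/
theorem polyTimeDecidable_of_cmd {P : DFAInput → Prop} (c : Cmd)
    (h : ∀ A : DFAInput, (c.run A.params A.init).reg .acc ≠ 0 ↔ P A) : PolyTimeDecidable P := by
  obtain ⟨p, hp⟩ := c.exists_polynomial_cost_le
  refine computableInPolyTime .heap .heap (decider c)
    ((p + 8) * (40 * (Polynomial.X + 4 + p + 1) ^ 2)) fun A => ?_
  -- Both parameters are entries of the unary encoded list, hence at most the length of the input.
  have hc : c.cost A.params ≤ p.eval A.encode.length := hp _ _ fun b => by
    cases b
    · exact le_length_unaryCode (by simp [params, numbers])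
    · exact le_length_unaryCode (by simp [params, numbers])
  obtain ⟨t, ht, he⟩ := within_decider c A (A.encode.length + 4 + p.eval A.encode.length)
    (by omega)
  refine ⟨t, ht.trans ?_, ?_⟩
  · simp only [Polynomial.eval_mul, Polynomial.eval_add, Polynomial.eval_pow, Polynomial.eval_X,
      Polynomial.eval_one, Polynomial.eval_ofNat]
    gcongr
  · have e : ∀ s : List Bool, (Mem.mk s [] [] fun _ => 0).contents =
        update (fun _ => []) Stk.heap s := fun s => by
      funext k
      cases k <;> simp [contents]
    rw [e, e] at he
    convert he using 2
    simp only [Computability.encodeBool, List.pure_def, List.cons.injEq, and_true]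
    exact decide_eq_decide.2 (h A).symm

end DFAInput

/-! ### Backward reachability by marking predecessors. -/

namespace DFA

open Function

variable {α : Type u} {σ : Type v}

/-- The states from which a set of states can be reached. -/
def coreach (M : DFA α σ) (T : Set σ) : Set σ :=
  {q | ∃ x, M.evalFrom q x ∈ T}

/-- A set of states that contains all predecessors of its elements. -/
def IsBackwardClosed (M : DFA α σ) (C : Set σ) : Prop :=
  ∀ q a, M.step q a ∈ C → q ∈ C

theorem subset_coreach (M : DFA α σ) (T : Set σ) : T ⊆ M.coreach T :=
  fun _ hq => ⟨[], hq⟩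

theorem isBackwardClosed_coreach (M : DFA α σ) (T : Set σ) :
    M.IsBackwardClosed (M.coreach T) :=
  fun _ a ⟨x, hx⟩ => ⟨a :: x, hx⟩

/-- A longer word visits some state twice, and the loop between the visits can be cut out. -/
theorem exists_short_word [Fintype σ] (M : DFA α σ) {T : Set σ} {q : σ} (h : q ∈ M.coreach T) :
    ∃ x : List α, x.length ≤ Fintype.card σ ∧ M.evalFrom q x ∈ T := by
  obtain ⟨x, hx⟩ := h
  induction hn : x.length using Nat.strong_induction_on generalizing x with
  | _ n ih =>
    by_cases hle : x.length ≤ Fintype.card σ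
    · exact ⟨x, hle, hx⟩
    · obtain ⟨r, a, b, c, rfl, -, hb, h₁, h₂, h₃⟩ := M.evalFrom_split (le_of_not_ge hle) rfl
      have hb' := List.length_pos_of_ne_nil hb
      refine ih (a ++ c).length ?_ (a ++ c) ?_ rfl
      · simp only [← hn, List.length_append]
        omega
      · rw [evalFrom_of_append, h₁, h₃]
        exact hx

/-- The states which are marked in a memory, if the mark of `q` has the address `pos q`. -/
def marked (pos : σ → ℕ) (mem : ℕ → ℕ) : Set σ :=
  {q | mem (pos q) ≠ 0}

/-- The marks in `mem` lie between `T` and `M.coreach T`, and contain all states from which `T`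
is reached by a word of length at most `i`. -/
structure MarkedUpTo (M : DFA α σ) (pos : σ → ℕ) (T : Set σ) (i : ℕ) (mem : ℕ → ℕ) : Prop where
  sound : marked pos mem ⊆ M.coreach T
  complete : ∀ q (x : List α), x.length ≤ i → M.evalFrom q x ∈ T → q ∈ marked pos mem

theorem MarkedUpTo.marked_eq [Fintype σ] {M : DFA α σ} {pos : σ → ℕ} {T : Set σ} {i : ℕ}
    {mem : ℕ → ℕ} (h : M.MarkedUpTo pos T i mem) (hi : Fintype.card σ ≤ i) :
    marked pos mem = M.coreach T := by
  refine h.sound.antisymm fun q hq => ?_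
  obtain ⟨x, hx, hxT⟩ := M.exists_short_word hq
  exact h.complete q x (hx.trans hi) hxT

theorem markedUpTo_zero (M : DFA α σ) (pos : σ → ℕ) (mem : ℕ → ℕ) :
    M.MarkedUpTo pos (marked pos mem) 0 mem where
  sound := M.subset_coreach _
  complete q x hx h := by
    rw [List.length_eq_zero_iff.1 (Nat.le_zero.1 hx)] at h
    exact h

/-- The marks in `mem` arise from the set `B` by marking predecessors, and the transitions
in `D` have been looked at. -/
structure MarkPass (M : DFA α σ) (pos : σ → ℕ) (B : Set σ) (D : Set (σ × α)) (mem : ℕ → ℕ) :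
    Prop where
  mono : B ⊆ marked pos mem
  sound : ∀ C, B ⊆ C → M.IsBackwardClosed C → marked pos mem ⊆ C
  done : ∀ q a, (q, a) ∈ D → M.step q a ∈ B → q ∈ marked pos mem

theorem markPass_empty (M : DFA α σ) (pos : σ → ℕ) (mem : ℕ → ℕ) :
    M.MarkPass pos (marked pos mem) ∅ mem where
  mono := subset_rfl
  sound _ h _ := h
  done _ _ h := h.elim

theorem marked_update {pos : σ → ℕ} (hpos : Injective pos) (mem : ℕ → ℕ) (q : σ) :
    marked pos (update mem (pos q) 1) = insert q (marked pos mem) := by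
  ext r
  by_cases hr : r = q
  · subst hr
    simp [marked]
  · simp [marked, hr, hpos.ne hr]

/-- Marks are updated in place, so a mark set earlier in the same pass may already be used. This is
sound, as every mark stays in each backward closed set containing `B`; completeness is only required
for successors in `B`, the marks at the start of the pass. -/
theorem MarkPass.step {M : DFA α σ} {pos : σ → ℕ} (hpos : Injective pos) {B : Set σ}
    {D D' : Set (σ × α)} {mem : ℕ → ℕ} (h : M.MarkPass pos B D mem) (q : σ) (a : α)
    (hD : ∀ t ∈ D', t ∈ D ∨ t = (q, a)) :
    M.MarkPass pos B D' (if mem (pos (M.step q a)) = 0 then mem else update mem (pos q) 1) := by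
  split_ifs with hm
  · refine ⟨h.mono, h.sound, fun r b hr hB => ?_⟩
    rcases hD _ hr with hr | hr
    · exact h.done r b hr hB
    · obtain ⟨rfl, rfl⟩ := Prod.mk.inj hr
      exact absurd hm (h.mono hB)
  · refine ⟨?_, fun C hC hC' => ?_, fun r b hr hB => ?_⟩
    · rw [marked_update hpos]
      exact h.mono.trans (Set.subset_insert _ _)
    · rw [marked_update hpos]
      exact Set.insert_subset (hC' q a (h.sound C hC hC' hm)) (h.sound C hC hC')
    · rw [marked_update hpos]
      rcases hD _ hr with hr | hr
      · exact Or.inr (h.done r b hr hB)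
      · exact Or.inl (Prod.mk.inj hr).1

theorem MarkPass.congr {M : DFA α σ} {pos : σ → ℕ} {B : Set σ} {D D' : Set (σ × α)}
    {mem : ℕ → ℕ} (h : M.MarkPass pos B D mem) (hD : D' ⊆ D) : M.MarkPass pos B D' mem :=
  ⟨h.mono, h.sound, fun q a hqa => h.done q a (hD hqa)⟩

/-- A complete pass handles the first letter of a word; the remaining word is covered by the marks
before the pass. -/
theorem MarkedUpTo.succ {M : DFA α σ} {pos : σ → ℕ} {T : Set σ} {i : ℕ} {mem mem' : ℕ → ℕ}
    (h : M.MarkedUpTo pos T i mem) (h' : M.MarkPass pos (marked pos mem) Set.univ mem') :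
    M.MarkedUpTo pos T (i + 1) mem' where
  sound := h'.sound _ h.sound (M.isBackwardClosed_coreach T)
  complete q x hx hT := by
    cases x with
    | nil => exact h'.mono (h.complete q [] (Nat.zero_le _) hT)
    | cons a x => exact h'.done q a trivial (h.complete _ x (by simpa using hx) hT)

end DFA

/-- The invariant rule for loops, where the invariant knows the number of completed rounds. -/
theorem Function.iterate_indexed_induction {β : Type u} {f : β → β} {n : ℕ} (I : ℕ → β → Prop) {s : β}
    (h₀ : I 0 s) (h : ∀ i s, i < n → I i s → I (i + 1) (f s)) : I n (f^[n] s) := by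
  induction n with
  | zero => exact h₀
  | succ n ih =>
    rw [Function.iterate_succ_apply']
    exact h n _ (Nat.lt_succ_self n) (ih fun i s hi => h i s (by omega))

namespace List

theorem getD_flatMap {ι : Type u} {k : ℕ} (f : ι → List ℕ) (hf : ∀ i, (f i).length = k) (a : ℕ)
    (ha : a < k) : ∀ (l : List ι) (i : ℕ) (hi : i < l.length),
    (l.flatMap f).getD (i * k + a) 0 = (f l[i]).getD a 0 := by
  intro l
  induction l with
  | nil => intro i hi; simp at hi
  | cons b l ih =>
    intro i hi
    cases i with
    | zero =>
      rw [flatMap_cons, getD_append _ _ _ _ (by rw [hf]; omega)]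
      simp
    | succ i =>
      rw [flatMap_cons, getD_append_right _ _ _ _ (by rw [hf, Nat.add_mul]; omega), hf,
        show (i + 1) * k + a - k = i * k + a by rw [Nat.add_mul]; omega]
      exact ih i (by simpa using hi)

end List

/-! ### The command for universality. -/

namespace DFAInput

/-- The acceptance bits of the input serve as marks, so at the start exactly the accepting states
are marked. -/
theorem init_mem_bit (A : DFAInput) (q : Fin A.states) :
    A.init.mem (3 + q) ≠ 0 ↔ q ∈ A.dfa.accept := by
  classical
  simp only [init, numbers]
  rw [List.getD_append_right _ _ _ _ (by simp), List.getD_append _ _ _ _ (by simp)]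
  by_cases h : q ∈ A.dfa.accept <;> simp [h]

theorem init_mem_table (A : DFAInput) (q : Fin A.states) (a : Fin A.letters) :
    A.init.mem (3 + A.states + q * A.letters + a) = A.dfa.step q a := by
  classical
  simp only [init, numbers]
  rw [List.getD_append_right _ _ _ _ (by simp; omega), List.getD_append_right _ _ _ _ (by
    simp; omega)]
  have e : 3 + A.states + (q : ℕ) * A.letters + a - [A.states, A.letters, (A.dfa.start : ℕ)].length
      - ((List.finRange A.states).map fun q => if q ∈ A.dfa.accept then 1 else 0).length =
      q * A.letters + a := by
    simp
    omega
  rw [e, List.getD_flatMap _ (k := A.letters) (by simp) _ a.2 _ _ (by simp)]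
  simp

theorem length_numbers (A : DFAInput) :
    A.numbers.length = 3 + A.states + A.states * A.letters := by
  simp [numbers, List.length_flatMap]
  omega

/-- The memory behind the input is free and zero; the marks of pairs of states are placed there. -/
theorem init_mem_eq_zero (A : DFAInput) {i : ℕ} (hi : 3 + A.states + A.states * A.letters ≤ i) :
    A.init.mem i = 0 :=
  List.getD_eq_default _ _ (by rwa [length_numbers])

theorem init_mem_two (A : DFAInput) : A.init.mem 2 = A.dfa.start :=
  A.numbers_getD_two

end DFAInput

namespace Cmd

open Function

/-- Increments a register three times. -/
def incThree (r : Reg) : Cmd :=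
  inc r ;; inc r ;; inc r

/-- Sets a register to the address of the first mark. -/
def toMarks (r : Reg) : Cmd :=
  clr r ;; incThree r

/-- Sets a register to the address of the transition table. -/
def toTable (r : Reg) : Cmd :=
  toMarks r ;; loop false (inc r)

theorem iterate_run_inc (par : Bool → ℕ) (r : Reg) (n : ℕ) (s : RegMem) :
    (run par (inc r))^[n] s = ⟨update s.reg r (s.reg r + n), s.mem⟩ := by
  induction n with
  | zero => simp
  | succ n ih =>
    rw [iterate_succ_apply', ih]
    simp [run, add_assoc]

theorem run_toMarks (par : Bool → ℕ) (r : Reg) (s : RegMem) :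
    run par (toMarks r) s = ⟨update s.reg r 3, s.mem⟩ := by
  simp [toMarks, incThree, run]

theorem run_toTable (par : Bool → ℕ) (r : Reg) (s : RegMem) :
    run par (toTable r) s = ⟨update s.reg r (3 + par false), s.mem⟩ := by
  change (run par (inc r))^[par false] (run par (toMarks r) s) = _
  rw [iterate_run_inc, run_toMarks]
  simp

/-- Marks the address in the register `b` if the address in `addr` is marked. -/
def mark : Cmd :=
  load ;; ifz .acc skip (clr .acc ;; inc .acc ;; cpy .addr .b ;; store)

theorem run_mark (par : Bool → ℕ) (s : RegMem) :
    (run par mark s).mem = (if s.mem (s.reg .addr) = 0 then s.mem else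
      update s.mem (s.reg .b) 1) ∧
    ∀ r, r ≠ .addr → r ≠ .acc → (run par mark s).reg r = s.reg r := by
  by_cases h : s.mem (s.reg .addr) = 0
  · refine ⟨by simp [mark, run, h], fun r h₁ h₂ => by simp [mark, run, h, h₂]⟩
  · refine ⟨by simp [mark, run, h], fun r h₁ h₂ => by simp [mark, run, h, h₁, h₂]⟩

/-- Marks a state if the successor in the current entry of the table is marked. -/
def markPred : Cmd :=
  cpy .addr .a ;; load ;; cpy .addr .acc ;; incThree .addr ;; mark ;; inc .a

/-- Register `a` points to an entry of the transition table and `b` to the mark of the source state.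
The entry is the number of the successor, whose mark lies three cells further than that number. -/
theorem run_markPred (par : Bool → ℕ) (s : RegMem) :
    (run par markPred s).mem = (if s.mem (3 + s.mem (s.reg .a)) = 0 then s.mem else
      update s.mem (s.reg .b) 1) ∧
    (run par markPred s).reg .a = s.reg .a + 1 ∧ (run par markPred s).reg .b = s.reg .b := by
  simp only [markPred, incThree, run]
  refine ⟨?_, ?_, ?_⟩
  · rw [(run_mark _ _).1]
    simp [Nat.add_comm 3]
  · rw [update_self, (run_mark _ _).2 _ (by simp) (by simp)]
    simp
  · rw [update_of_ne (by simp), (run_mark _ _).2 _ (by simp) (by simp)]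
    simp

/-- Marks all states which have a marked successor. -/
def markPreds : Cmd :=
  toTable .a ;; toMarks .b ;; loop false (loop true markPred ;; inc .b)

/-- Marks all states from which a marked state can be reached. -/
def markCoreach : Cmd :=
  loop false markPreds

/-- Replaces the marked states by the unmarked ones. -/
def flipMarks : Cmd :=
  toMarks .b ;; loop false (cpy .addr .b ;; load ;; ifz .acc (inc .acc) (clr .acc) ;; store ;;
    inc .b)

/-- Decides whether a reachable universal state exists. -/
def universal : Cmd :=
  -- The marks are successively the non-dead states, the dead states, the states that can reach a
  -- dead one, the universal states, and the states that can reach a universal one.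
  markCoreach ;; flipMarks ;; markCoreach ;; flipMarks ;; markCoreach ;;
    -- The start state is stored at the address 2; its mark is the answer.
    clr .addr ;; inc .addr ;; inc .addr ;; load ;; cpy .addr .acc ;; incThree .addr ;; load

end Cmd

namespace DFAInput

open Function Cmd DFA

variable (A : DFAInput)

/-- The address of the mark of a state. -/
def pos (q : Fin A.states) : ℕ :=
  3 + q

theorem pos_injective : Injective A.pos := fun p q h => Fin.ext (by simpa [pos] using h)

/-- The memory is as in the beginning, except for the marks. -/
def Intact (mem : ℕ → ℕ) : Prop :=
  ∀ i, i < 3 ∨ 3 + A.states ≤ i → mem i = A.init.mem i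

variable {A}

theorem Intact.update {mem : ℕ → ℕ} (h : A.Intact mem) (q : Fin A.states) (n : ℕ) :
    A.Intact (update mem (A.pos q) n) := fun i hi => by
  rw [update_of_ne, h i hi]
  have := q.2
  simp only [pos]
  omega

theorem Intact.table {mem : ℕ → ℕ} (h : A.Intact mem) (q : Fin A.states) (a : Fin A.letters) :
    mem (3 + A.states + q * A.letters + a) = A.dfa.step q a := by
  rw [h _ (by omega), init_mem_table]

theorem run_markPreds {s : RegMem} (hs : A.Intact s.mem) :
    A.Intact (run A.params markPreds s).mem ∧
      A.dfa.MarkPass A.pos (marked A.pos s.mem) Set.univ (run A.params markPreds s).mem := by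
  -- The rows before `i` and the first `j` letters of row `i` have been processed. The table is
  -- consecutive, so `a` never has to be reset between rows.
  let I : ℕ → ℕ → RegMem → Prop := fun i j t =>
    t.reg .a = 3 + A.states + i * A.letters + j ∧ t.reg .b = 3 + i ∧ A.Intact t.mem ∧
      A.dfa.MarkPass A.pos (marked A.pos s.mem) {x | (x.1 : ℕ) < i ∨ (x.1 : ℕ) = i ∧ (x.2 : ℕ) < j}
        t.mem
  have inner : ∀ i j t, i < A.states → j < A.letters → I i j t →
      I i (j + 1) (run A.params markPred t) := by
    rintro i j t hi hj ⟨h₁, h₂, h₃, h₄⟩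
    obtain ⟨e₁, e₂, e₃⟩ := run_markPred A.params t
    have ht := h₃.table ⟨i, hi⟩ ⟨j, hj⟩
    dsimp only at ht
    rw [h₁, h₂, ht] at e₁
    refine ⟨by omega, by omega, ?_, ?_⟩
    · rw [e₁]
      split_ifs
      · exact h₃
      · exact h₃.update ⟨i, hi⟩ 1
    · rw [e₁]
      refine h₄.step A.pos_injective ⟨i, hi⟩ ⟨j, hj⟩ ?_
      rintro ⟨q, a⟩ hqa
      simp only [Set.mem_ofPred_eq, Prod.mk.injEq, Fin.ext_iff] at hqa ⊢
      omega
  have outer : ∀ i t, i < A.states → I i 0 t →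
      I (i + 1) 0 (run A.params (loop true markPred ;; inc .b) t) := by
    intro i t hi h
    have h' : I i A.letters (run A.params (loop true markPred) t) :=
      iterate_indexed_induction (I i) h fun j t hj => inner i j t hi hj
    obtain ⟨h₁, h₂, h₃, h₄⟩ := h'
    simp only [run] at h₁ h₂ h₃ h₄ ⊢
    refine ⟨?_, ?_, h₃, h₄.congr ?_⟩
    · simp [h₁, Nat.add_mul]
      omega
    · simp [h₂, add_assoc]
    · rintro ⟨q, a⟩ hqa
      have := a.2
      simp only [Set.mem_ofPred_eq] at hqa ⊢
      omega
  have h₀ : I 0 0 (run A.params (toMarks .b) (run A.params (toTable .a) s)) := by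
    rw [run_toTable, run_toMarks]
    refine ⟨by simp [params], by simp, hs, (markPass_empty _ _ _).congr ?_⟩
    rintro ⟨q, a⟩ hqa
    simp at hqa
  obtain ⟨-, -, h₃, h₄⟩ : I A.states 0 (run A.params markPreds s) :=
    iterate_indexed_induction (fun i => I i 0) h₀ outer
  exact ⟨h₃, h₄.congr fun x _ => Or.inl x.1.2⟩

theorem run_markCoreach {s : RegMem} (hs : A.Intact s.mem) :
    A.Intact (run A.params markCoreach s).mem ∧
      marked A.pos (run A.params markCoreach s).mem = A.dfa.coreach (marked A.pos s.mem) := by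
  obtain ⟨h₁, h₂⟩ := iterate_indexed_induction (n := A.states)
    (fun i t => A.Intact t.mem ∧ A.dfa.MarkedUpTo A.pos (marked A.pos s.mem) i t.mem)
    (f := run A.params markPreds) (s := s) ⟨hs, A.dfa.markedUpTo_zero _ _⟩
    (fun i t _ h => ⟨(run_markPreds h.1).1, h.2.succ (run_markPreds h.1).2⟩)
  exact ⟨h₁, h₂.marked_eq (by simp)⟩

theorem run_flipMarks {s : RegMem} (hs : A.Intact s.mem) :
    A.Intact (run A.params flipMarks s).mem ∧
      marked A.pos (run A.params flipMarks s).mem = (marked A.pos s.mem)ᶜ := by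
  obtain ⟨-, h⟩ := iterate_indexed_induction (n := A.states)
    (fun i t => t.reg .b = 3 + i ∧ ∀ j, t.mem j = if 3 ≤ j ∧ j < 3 + i then
      (if s.mem j = 0 then 1 else 0) else s.mem j)
    (f := run A.params (cpy .addr .b ;; load ;; ifz .acc (inc .acc) (clr .acc) ;; store ;; inc .b))
    (s := run A.params (toMarks .b) s) (by
      rw [run_toMarks]
      refine ⟨by simp, fun j => ?_⟩
      rw [if_neg (by omega)]) (by
      rintro i t hi ⟨h₁, h₂⟩
      have h₃ := h₂ (3 + i)
      rw [if_neg (by omega)] at h₃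
      refine ⟨?_, fun j => ?_⟩
      · by_cases h : s.mem (3 + i) = 0 <;> simp [run, h₁, h₃, h, add_assoc]
      · by_cases hj : j = 3 + i
        · subst hj
          by_cases h : s.mem (3 + i) = 0 <;> simp [run, h₁, h₃, h]
        · have e : (run A.params (cpy .addr .b ;; load ;; ifz .acc (inc .acc) (clr .acc) ;; store ;;
              inc .b) t).mem j = t.mem j := by
            by_cases h : s.mem (3 + i) = 0 <;> simp [run, h₁, h₃, h, hj]
          rw [e, h₂]
          congr 1
          simp only [eq_iff_iff]
          omega)
  have h' : ∀ j, (run A.params flipMarks s).mem j = if 3 ≤ j ∧ j < 3 + A.states then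
      (if s.mem j = 0 then 1 else 0) else s.mem j := h
  refine ⟨fun i hi => ?_, ?_⟩
  · rw [h', if_neg (by omega), hs i hi]
  · ext q
    have := q.2
    simp only [marked, Set.mem_ofPred_eq, Set.mem_compl_iff, h', pos]
    rw [if_pos (by omega)]
    split_ifs with h <;> simp [h]

theorem run_universal :
    (run A.params universal A.init).reg .acc ≠ 0 ↔ A.dfa.start ∈ A.dfa.coreach
      (A.dfa.coreach (A.dfa.coreach A.dfa.accept)ᶜ)ᶜ := by
  have e : marked A.pos A.init.mem = A.dfa.accept := Set.ext fun q => A.init_mem_bit q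
  have h₀ : A.Intact A.init.mem := fun _ _ => rfl
  obtain ⟨i₁, m₁⟩ := run_markCoreach h₀
  obtain ⟨i₂, m₂⟩ := run_flipMarks i₁
  obtain ⟨i₃, m₃⟩ := run_markCoreach i₂
  obtain ⟨i₄, m₄⟩ := run_flipMarks i₃
  obtain ⟨i₅, m₅⟩ := run_markCoreach i₄
  rw [m₄, m₃, m₂, m₁, e] at m₅
  rw [← m₅]
  have h₂ := (i₅ 2 (by omega)).trans A.init_mem_two
  simp only [universal, incThree, run, marked, pos, Set.mem_ofPred_eq] at h₂ ⊢
  simp [h₂, Nat.add_comm 3]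

end DFAInput

/-! ### The square automaton and the command for synchronization. -/

namespace DFA

variable {α : Type u} {σ : Type v}

/-- The DFA that reads a word from two states at the same time. -/
def square (M : DFA α σ) : DFA α (σ × σ) where
  step x a := (M.step x.1 a, M.step x.2 a)
  start := (M.start, M.start)
  accept := {x | x.1 = x.2}

theorem square_evalFrom (M : DFA α σ) (x : σ × σ) (w : List α) :
    M.square.evalFrom x w = (M.evalFrom x.1 w, M.evalFrom x.2 w) := by
  induction w generalizing x with
  | nil => rfl
  | cons a w ih => exact ih _

/-- States are merged one at a time: a word that merges `S` is prolonged by one that merges the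
image of a new state with the common image of `S`. Merged states remain merged. -/
theorem hasSynchronizingWord_iff_coreach [Finite σ] (M : DFA α σ) :
    M.HasSynchronizingWord ↔ ∀ x, x ∈ M.square.coreach M.square.accept := by
  classical
  constructor
  · rintro ⟨w, hw⟩ x
    refine ⟨w, ?_⟩
    rw [square_evalFrom]
    exact hw x.1 x.2
  · intro h
    have key : ∀ S : Finset σ, ∃ w, ∀ p ∈ S, ∀ q ∈ S, M.evalFrom p w = M.evalFrom q w := by
      intro S
      induction S using Finset.induction_on with
      | empty => exact ⟨[], by simp⟩
      | insert r S _ ih =>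
        obtain ⟨w, hw⟩ := ih
        obtain rfl | ⟨p, hp⟩ := S.eq_empty_or_nonempty
        · exact ⟨[], by simp⟩
        obtain ⟨x, hx⟩ := h (M.evalFrom r w, M.evalFrom p w)
        rw [square_evalFrom] at hx
        have hx' : M.evalFrom r (w ++ x) = M.evalFrom p (w ++ x) := by
          rw [evalFrom_of_append, evalFrom_of_append]
          exact hx
        have hS : ∀ q ∈ insert r S, M.evalFrom q (w ++ x) = M.evalFrom p (w ++ x) := by
          intro q hq
          rcases Finset.mem_insert.1 hq with rfl | hq
          · exact hx'
          · rw [evalFrom_of_append, evalFrom_of_append, hw q hq p hp]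
        exact ⟨w ++ x, fun q hq q' hq' => (hS q hq).trans (hS q' hq').symm⟩
    have := Fintype.ofFinite σ
    obtain ⟨w, hw⟩ := key Finset.univ
    exact ⟨w, fun p q => hw p (Finset.mem_univ p) q (Finset.mem_univ q)⟩

end DFA

namespace Cmd

open Function

/-- Repeats a command as often as the value of `acc` says, which is at most the number of
states. -/
def repeatAcc (g : Cmd) : Cmd :=
  loop false (ifz .acc skip (dec .acc ;; g))

/-- The loop always makes `par false` rounds, but those after `acc` has become zero are idle; hence
the minimum in the invariant. With a body that itself adds the number of states, this multiplies. -/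
theorem run_repeatAcc (par : Bool → ℕ) {g : Cmd} {m : ℕ}
    (hg : ∀ s, run par g s = ⟨update s.reg .f (s.reg .f + m), s.mem⟩) (s : RegMem)
    (hs : s.reg .acc ≤ par false) :
    run par (repeatAcc g) s =
      ⟨update (update s.reg .acc 0) .f (s.reg .f + s.reg .acc * m), s.mem⟩ := by
  have key : ∀ i, (run par (ifz .acc skip (dec .acc ;; g)))^[i] s =
      ⟨update (update s.reg .acc (s.reg .acc - i)) .f (s.reg .f + min i (s.reg .acc) * m),
        s.mem⟩ := by
    intro i
    induction i with
    | zero => simp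
    | succ i ih =>
      rw [iterate_succ_apply', ih]
      simp only [run, hg]
      rcases Nat.lt_or_ge i (s.reg .acc) with h | h
      · have h' : s.reg .acc - i ≠ 0 := by omega
        simp only [ne_eq, reduceCtorEq, not_false_eq_true, update_of_ne, update_self, h', if_false,
          min_eq_left h.le, min_eq_left (Nat.succ_le_of_lt h), RegMem.mk.injEq, and_true]
        funext r
        cases r <;> simp [Nat.add_mul, Nat.sub_sub, add_assoc]
      · have h' : s.reg .acc - i = 0 := by omega
        have h'' : s.reg .acc - (i + 1) = 0 := by omega
        simp [h', h'', min_eq_right h, min_eq_right (h.trans (Nat.le_succ i))]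
  change (run par (ifz .acc skip (dec .acc ;; g)))^[par false] s = _
  rw [key, Nat.sub_eq_zero_of_le hs, min_eq_right hs]

theorem run_loop_inc (par : Bool → ℕ) (b : Bool) (r : Reg) (s : RegMem) :
    run par (loop b (inc r)) s = ⟨update s.reg r (s.reg r + par b), s.mem⟩ :=
  iterate_run_inc par r (par b) s

theorem run_loop_loop (par : Bool → ℕ) (b b' : Bool) (c : Cmd) (s : RegMem) :
    run par (loop b (loop b' c)) s = (run par c)^[par b' * par b] s := by
  rw [iterate_mul]
  rfl

/-- Marks a pair of states if the successor in the current two entries of the table is marked. -/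
def markPairPred : Cmd :=
  cpy .addr .d ;; load ;; cpy .f .c ;; repeatAcc (loop false (inc .f)) ;;
    cpy .addr .e ;; load ;; repeatAcc (inc .f) ;; cpy .addr .f ;; mark ;; inc .d ;; inc .e

/-- Here `d` and `e` point to the table entries of the two components, `b` to the mark of the pair,
and `c` to the first mark of a pair. The address of the mark of the successor pair is computed in
`f`. -/
theorem run_markPairPred (par : Bool → ℕ) (s : RegMem) (hd : s.mem (s.reg .d) ≤ par false)
    (he : s.mem (s.reg .e) ≤ par false) :
    (run par markPairPred s).mem =
      (if s.mem (s.reg .c + s.mem (s.reg .d) * par false + s.mem (s.reg .e)) = 0 then s.mem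
        else update s.mem (s.reg .b) 1) ∧
    (run par markPairPred s).reg .a = s.reg .a ∧ (run par markPairPred s).reg .b = s.reg .b ∧
    (run par markPairPred s).reg .c = s.reg .c ∧
    (run par markPairPred s).reg .d = s.reg .d + 1 ∧
    (run par markPairPred s).reg .e = s.reg .e + 1 := by
  have h : run par (cpy .addr .f) (run par (repeatAcc (inc .f)) (run par (cpy .addr .e ;; load)
      (run par (repeatAcc (loop false (inc .f))) (run par (cpy .addr .d ;; load ;; cpy .f .c) s)))) =
      ⟨update (update (update s.reg .acc 0) .f
        (s.reg .c + s.mem (s.reg .d) * par false + s.mem (s.reg .e))) .addr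
          (s.reg .c + s.mem (s.reg .d) * par false + s.mem (s.reg .e)), s.mem⟩ := by
    simp only [run]
    rw [run_repeatAcc par (run_loop_inc par false .f) _ (by simpa using hd)]
    rw [run_repeatAcc par (g := inc .f) (m := 1) (fun _ => rfl) _ (by simpa using he)]
    simp only [RegMem.mk.injEq, and_true]
    funext r
    cases r <;> simp
  rw [show run par markPairPred s = run par (mark ;; inc .d ;; inc .e) _ from
    congrArg (run par (mark ;; inc .d ;; inc .e)) h]
  simp only [run]
  refine ⟨?_, ?_, ?_, ?_, ?_, ?_⟩
  · rw [(run_mark _ _).1]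
    simp
  all_goals simp [(run_mark _ _).2]

/-- Marks all pairs of states which have a marked successor. -/
def markPairPreds : Cmd :=
  toTable .a ;; cpy .b .c ;; loop false (toTable .e ;;
    loop false (cpy .d .a ;; loop true markPairPred ;; inc .b) ;; loop true (inc .a))

/-- Marks the pairs of equal states, and stores the address of the first mark in `c`. -/
def markDiag : Cmd :=
  toTable .c ;; loop false (loop true (inc .c)) ;; cpy .b .c ;;
    loop false (cpy .addr .b ;; clr .acc ;; inc .acc ;; store ;; inc .b ;; loop false (inc .b))

/-- Tests whether all pairs of states are marked. -/
def allMarked : Cmd :=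
  clr .d ;; inc .d ;; cpy .b .c ;;
    loop false (loop false (cpy .addr .b ;; load ;; ifz .acc (clr .d) skip ;; inc .b)) ;;
    cpy .acc .d

/-- Decides whether a synchronizing word exists. -/
def synchronizing : Cmd :=
  markDiag ;; loop false (loop false markPairPreds) ;; allMarked

end Cmd

namespace DFAInput

open Function Cmd DFA

variable (A : DFAInput)

/-- The address of the mark of the first pair of states. -/
def base : ℕ :=
  3 + A.states + A.states * A.letters

/-- The address of the mark of a pair of states. -/
def pairPos (x : Fin A.states × Fin A.states) : ℕ :=
  A.base + (finProdFinEquiv x : ℕ)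

theorem pairPos_injective : Injective A.pairPos := fun x y h =>
  finProdFinEquiv.injective (Fin.ext (by simpa [pairPos] using h))

theorem pairPos_mk (p q : Fin A.states) : A.pairPos (p, q) = A.base + p * A.states + q := by
  simp only [pairPos, finProdFinEquiv_apply_val]
  rw [Nat.mul_comm]
  omega

/-- The memory below the marks of pairs is as in the beginning. -/
def PairIntact (mem : ℕ → ℕ) : Prop :=
  ∀ i < A.base, mem i = A.init.mem i

variable {A}

theorem PairIntact.update {mem : ℕ → ℕ} (h : A.PairIntact mem) (x : Fin A.states × Fin A.states)
    (n : ℕ) : A.PairIntact (update mem (A.pairPos x) n) := fun i hi => by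
  rw [update_of_ne, h i hi]
  simp only [pairPos]
  omega

theorem table_lt_base (q : Fin A.states) (a : Fin A.letters) :
    3 + A.states + q * A.letters + a < A.base := by
  have h₁ := Nat.mul_le_mul_right A.letters (Nat.succ_le_of_lt q.2)
  have h₂ := a.2
  rw [Nat.succ_mul] at h₁
  unfold base
  omega

theorem PairIntact.table {mem : ℕ → ℕ} (h : A.PairIntact mem) (q : Fin A.states)
    (a : Fin A.letters) : mem (3 + A.states + q * A.letters + a) = A.dfa.step q a := by
  rw [h _ (table_lt_base q a), init_mem_table]

theorem run_markPairPreds {s : RegMem} (hs : A.PairIntact s.mem) (hc : s.reg .c = A.base) :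
    A.PairIntact (run A.params markPairPreds s).mem ∧
      (run A.params markPairPreds s).reg .c = A.base ∧
      A.dfa.square.MarkPass A.pairPos (marked A.pairPos s.mem) Set.univ
        (run A.params markPairPreds s).mem := by
  -- The indices are the first state, the second state and the letter. `Q` adds the two table
  -- pointers of the innermost loop, while `a` stays at the start of row `i`.
  let P : ℕ → ℕ → ℕ → RegMem → Prop := fun i j l t =>
    t.reg .a = 3 + A.states + i * A.letters ∧ t.reg .b = A.base + i * A.states + j ∧
      t.reg .c = A.base ∧ A.PairIntact t.mem ∧
      A.dfa.square.MarkPass A.pairPos (marked A.pairPos s.mem)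
        {x | (x.1.1 : ℕ) < i ∨ (x.1.1 : ℕ) = i ∧ ((x.1.2 : ℕ) < j ∨
          (x.1.2 : ℕ) = j ∧ (x.2 : ℕ) < l)} t.mem
  let Q : ℕ → ℕ → ℕ → RegMem → Prop := fun i j l t => P i j l t ∧
    t.reg .d = 3 + A.states + i * A.letters + l ∧ t.reg .e = 3 + A.states + j * A.letters + l
  have inner : ∀ i j l t, i < A.states → j < A.states → l < A.letters → Q i j l t →
      Q i j (l + 1) (run A.params markPairPred t) := by
    rintro i j l t hi hj hl ⟨⟨h₁, h₂, h₃, h₄, h₅⟩, h₆, h₇⟩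
    have ht := h₄.table ⟨i, hi⟩ ⟨l, hl⟩
    have ht' := h₄.table ⟨j, hj⟩ ⟨l, hl⟩
    dsimp only at ht ht'
    obtain ⟨e₁, e₂, e₃, e₄, e₅, e₆⟩ := run_markPairPred A.params t
      (by rw [h₆, ht]; exact (A.dfa.step _ _).2.le) (by rw [h₇, ht']; exact (A.dfa.step _ _).2.le)
    have hp := A.pairPos_mk ⟨i, hi⟩ ⟨j, hj⟩
    have hp' := A.pairPos_mk (A.dfa.step ⟨i, hi⟩ ⟨l, hl⟩) (A.dfa.step ⟨j, hj⟩ ⟨l, hl⟩)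
    rw [h₆, h₇, ht, ht', h₃, show A.params false = A.states from rfl, ← hp', h₂, ← hp] at e₁
    refine ⟨⟨by omega, by omega, by omega, ?_, ?_⟩, by omega, by omega⟩
    · rw [e₁]
      split_ifs
      · exact h₄
      · exact h₄.update (⟨i, hi⟩, ⟨j, hj⟩) 1
    · rw [e₁]
      refine h₅.step A.pairPos_injective (⟨i, hi⟩, ⟨j, hj⟩) ⟨l, hl⟩ ?_
      rintro ⟨⟨p, q⟩, a⟩ hqa
      simp only [Set.mem_ofPred_eq, Prod.mk.injEq, Fin.ext_iff] at hqa ⊢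
      omega
  -- After all letters of row `j`, the pointer `e` is already at row `j + 1`; only `d` has to return
  -- to the start of row `i`.
  have middle : ∀ i j t, i < A.states → j < A.states →
      P i j 0 t ∧ t.reg .e = 3 + A.states + j * A.letters →
      P i (j + 1) 0 (run A.params (cpy .d .a ;; loop true markPairPred ;; inc .b) t) ∧
        (run A.params (cpy .d .a ;; loop true markPairPred ;; inc .b) t).reg .e =
          3 + A.states + (j + 1) * A.letters := by
    rintro i j t hi hj ⟨h, he⟩
    have h₀ : Q i j 0 (run A.params (cpy .d .a) t) := by
      obtain ⟨h₁, h₂, h₃, h₄, h₅⟩ := h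
      exact ⟨⟨by simpa [run] using h₁, by simpa [run] using h₂, by simpa [run] using h₃, h₄, h₅⟩,
        by simpa [run] using h₁, by simpa [run] using he⟩
    obtain ⟨⟨h₁, h₂, h₃, h₄, h₅⟩, h₆, h₇⟩ : Q i j A.letters
        (run A.params (loop true markPairPred) (run A.params (cpy .d .a) t)) :=
      iterate_indexed_induction (Q i j) h₀ fun l t hl => inner i j l t hi hj hl
    change P i (j + 1) 0 (run A.params (inc .b) (run A.params (loop true markPairPred)
      (run A.params (cpy .d .a) t))) ∧ (run A.params (inc .b) (run A.params (loop true markPairPred)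
        (run A.params (cpy .d .a) t))).reg .e = _
    generalize run A.params (loop true markPairPred) (run A.params (cpy .d .a) t) = t' at *
    refine ⟨⟨by simpa [run] using h₁, by simp [run, h₂, add_assoc], by simpa [run] using h₃, h₄,
      h₅.congr ?_⟩, ?_⟩
    · rintro ⟨⟨p, q⟩, a⟩ hqa
      have := a.2
      simp only [Set.mem_ofPred_eq] at hqa ⊢
      omega
    · simp [run, h₇, Nat.add_mul, add_assoc]
  have outer : ∀ i t, i < A.states → P i 0 0 t → P (i + 1) 0 0 (run A.params (toTable .e ;;
      loop false (cpy .d .a ;; loop true markPairPred ;; inc .b) ;; loop true (inc .a)) t) := by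
    intro i t hi h
    have h₀ : P i 0 0 (run A.params (toTable .e) t) ∧
        (run A.params (toTable .e) t).reg .e = 3 + A.states + 0 * A.letters := by
      rw [run_toTable]
      obtain ⟨h₁, h₂, h₃, h₄, h₅⟩ := h
      exact ⟨⟨by simpa using h₁, by simpa using h₂, by simpa using h₃, h₄, h₅⟩, by simp [params]⟩
    obtain ⟨⟨h₁, h₂, h₃, h₄, h₅⟩, -⟩ := iterate_indexed_induction (n := A.states)
      (fun j t => P i j 0 t ∧ t.reg .e = 3 + A.states + j * A.letters) h₀
      (fun j t hj => middle i j t hi hj)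
    change P (i + 1) 0 0 (run A.params (loop true (inc .a)) ((run A.params (cpy .d .a ;;
      loop true markPairPred ;; inc .b))^[A.states] (run A.params (toTable .e) t)))
    rw [run_loop_inc]
    refine ⟨?_, ?_, by simpa using h₃, h₄, h₅.congr ?_⟩
    · simp [h₁, Nat.add_mul, params, add_assoc]
    · simp [h₂, Nat.add_mul, add_assoc]
    · rintro ⟨⟨p, q⟩, a⟩ hqa
      have := q.2
      simp only [Set.mem_ofPred_eq] at hqa ⊢
      omega
  have h₀ : P 0 0 0 (run A.params (cpy .b .c) (run A.params (toTable .a) s)) := by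
    rw [run_toTable]
    refine ⟨by simp [run, params], by simp [run, hc], by simp [run, hc], hs,
      (markPass_empty _ _ _).congr ?_⟩
    rintro ⟨⟨p, q⟩, a⟩ hqa
    simp at hqa
  obtain ⟨-, -, h₃, h₄, h₅⟩ : P A.states 0 0 (run A.params markPairPreds s) :=
    iterate_indexed_induction (fun i => P i 0 0) h₀ outer
  exact ⟨h₄, h₃, h₅.congr fun x _ => Or.inl x.1.1.2⟩

theorem run_markDiag :
    A.PairIntact (run A.params markDiag A.init).mem ∧
      (run A.params markDiag A.init).reg .c = A.base ∧
      marked A.pairPos (run A.params markDiag A.init).mem = A.dfa.square.accept := by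
  have e : run A.params (loop false (loop true (inc .c))) (run A.params (toTable .c) A.init) =
      ⟨update A.init.reg .c A.base, A.init.mem⟩ := by
    rw [run_loop_loop, iterate_run_inc, run_toTable]
    simp [params, base, Nat.mul_comm]
  -- Consecutive marks on the diagonal are `A.states + 1` cells apart.
  obtain ⟨-, h₂, h₃, h₄⟩ := iterate_indexed_induction (n := A.states)
    (fun i t => t.reg .b = A.base + i * A.states + i ∧ t.reg .c = A.base ∧ A.PairIntact t.mem ∧
      marked A.pairPos t.mem = {x | x.1 = x.2 ∧ (x.1 : ℕ) < i})
    (f := run A.params (cpy .addr .b ;; clr .acc ;; inc .acc ;; store ;; inc .b ;;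
      loop false (inc .b)))
    (s := run A.params (cpy .b .c) ⟨update A.init.reg .c A.base, A.init.mem⟩)
    (by
      refine ⟨by simp [run], by simp [run], fun _ _ => rfl, ?_⟩
      ext x
      have : A.init.mem (A.pairPos x) = 0 := A.init_mem_eq_zero (Nat.le_add_right _ _)
      simp [run, marked, this])
    (by
      rintro i t hi ⟨h₁, h₂, h₃, h₄⟩
      have hm : (run A.params (cpy .addr .b ;; clr .acc ;; inc .acc ;; store ;; inc .b ;;
          loop false (inc .b)) t).mem =
          update t.mem (A.pairPos (⟨i, hi⟩, ⟨i, hi⟩)) 1 := by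
        simp only [run.eq_2, run_loop_inc, pairPos_mk]
        simp [run, h₁]
      refine ⟨?_, ?_, ?_, ?_⟩
      · simp only [run.eq_2, run_loop_inc]
        simp [run, h₁, params, Nat.add_mul]
        omega
      · simp only [run.eq_2, run_loop_inc]
        simp [run, h₂]
      · rw [hm]
        exact h₃.update _ 1
      · rw [hm, marked_update A.pairPos_injective, h₄]
        ext ⟨p, q⟩
        simp only [Set.mem_insert_iff, Set.mem_ofPred_eq, Prod.mk.injEq, Fin.ext_iff]
        omega)
  rw [← e] at h₂ h₃ h₄
  refine ⟨h₃, h₂, h₄.trans ?_⟩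
  ext x
  simp [square]

theorem run_allMarked {s : RegMem} (hc : s.reg .c = A.base) :
    (run A.params allMarked s).reg .acc ≠ 0 ↔ ∀ x, x ∈ marked A.pairPos s.mem := by
  -- The nested loops form one iteration over all pairs. Register `d` is a flag that is cleared at
  -- the first unmarked pair.
  obtain ⟨-, h₂, h₃⟩ := iterate_indexed_induction (n := A.states * A.states)
    (fun i t => t.reg .b = A.base + i ∧ t.mem = s.mem ∧
      (t.reg .d ≠ 0 ↔ ∀ j < i, s.mem (A.base + j) ≠ 0))
    (f := run A.params (cpy .addr .b ;; load ;; ifz .acc (clr .d) skip ;; inc .b))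
    (s := run A.params (clr .d ;; inc .d ;; cpy .b .c) s)
    (by simp [run, hc])
    (by
      rintro i t hi ⟨h₁, h₂, h₃⟩
      simp only [Nat.forall_lt_succ_right, ← h₃]
      by_cases h : s.mem (A.base + i) = 0 <;> simp [run, h₁, h₂, h, add_assoc])
  have e : (run A.params allMarked s).reg .acc = ((run A.params (cpy .addr .b ;; load ;;
      ifz .acc (clr .d) skip ;; inc .b))^[A.states * A.states]
        (run A.params (clr .d ;; inc .d ;; cpy .b .c) s)).reg .d := by
    rw [show A.states * A.states = A.params false * A.params false from rfl, ← run_loop_loop]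
    simp [allMarked, run]
  rw [e, h₃]
  constructor
  · intro h x
    exact h _ (finProdFinEquiv x).2
  · intro h j hj
    have hx := h (finProdFinEquiv.symm ⟨j, hj⟩)
    rwa [marked, Set.mem_ofPred_eq, pairPos, Equiv.apply_symm_apply] at hx

theorem run_synchronizing :
    (run A.params synchronizing A.init).reg .acc ≠ 0 ↔ A.dfa.HasSynchronizingWord := by
  obtain ⟨h₁, h₂, h₃⟩ := run_markDiag (A := A)
  -- The square automaton has `A.states * A.states` states, so this many rounds complete the
  -- closure.
  have h := iterate_indexed_induction (n := A.states * A.states)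
    (fun i t => A.PairIntact t.mem ∧ t.reg .c = A.base ∧
      A.dfa.square.MarkedUpTo A.pairPos A.dfa.square.accept i t.mem)
    (f := run A.params markPairPreds) (s := run A.params markDiag A.init)
    ⟨h₁, h₂, h₃ ▸ A.dfa.square.markedUpTo_zero _ _⟩
    (fun i t _ h => ⟨(run_markPairPreds h.1 h.2.1).1, (run_markPairPreds h.1 h.2.1).2.1,
      h.2.2.succ (run_markPairPreds h.1 h.2.1).2.2⟩)
  rw [show A.states * A.states = A.params false * A.params false from rfl, ← run_loop_loop] at h
  rw [hasSynchronizingWord_iff_coreach, ← h.2.2.marked_eq (by simp [params]), ← run_allMarked h.2.1]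
  rfl

end DFAInput

/-! ### Factors, dead states and universal states. -/

namespace DFA

variable {α : Type u} {σ : Type v} (M : DFA α σ)

/-- The prefix of an accepted word supplies the reachable state, and the suffix witnesses that the
state after `y` is not dead. -/
theorem mem_factors_accepts {y : List α} :
    y ∈ M.accepts.factors ↔ ∃ q, M.IsReachable q ∧ ¬ M.IsDead (M.evalFrom q y) := by
  constructor
  · rintro ⟨_, hw, x, z, rfl⟩
    refine ⟨M.eval x, ⟨x, rfl⟩, fun h => h z ?_⟩
    rwa [mem_accepts, eval, evalFrom_of_append, evalFrom_of_append] at hw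
  · rintro ⟨_, ⟨x, rfl⟩, h⟩
    obtain ⟨z, hz⟩ := not_forall_not.1 h
    refine ⟨x ++ y ++ z, ?_, x, z, rfl⟩
    rw [mem_accepts, eval, evalFrom_of_append, evalFrom_of_append]
    exact hz

variable {M}

theorem IsDead.evalFrom {q : σ} (h : M.IsDead q) (x : List α) : M.IsDead (M.evalFrom q x) :=
  fun y => by
    rw [← evalFrom_of_append]
    exact h (x ++ y)

theorem IsReachable.evalFrom {q : σ} (h : M.IsReachable q) (x : List α) :
    M.IsReachable (M.evalFrom q x) := by
  obtain ⟨y, rfl⟩ := h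
  exact ⟨y ++ x, M.evalFrom_of_append _ _ _⟩

variable (M)

theorem factors_accepts_eq_top_of_universal
    (h : ∃ q, M.IsReachable q ∧ M.IsUniversalState q) : M.accepts.factors = ⊤ := by
  obtain ⟨q, hq, hu⟩ := h
  exact Set.eq_univ_of_forall fun y => M.mem_factors_accepts.2 ⟨q, hq, hu y⟩

/-- Without a reachable universal state, a word killing all reachable states is built by induction
over finite sets of them; it is not a factor. -/
theorem factors_accepts_eq_top_iff [Finite σ] :
    M.accepts.factors = ⊤ ↔ ∃ q, M.IsReachable q ∧ M.IsUniversalState q := by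
  classical
  refine ⟨fun h => ?_, M.factors_accepts_eq_top_of_universal⟩
  by_contra! hu
  have key : ∀ S : Finset σ, (∀ q ∈ S, M.IsReachable q) →
      ∃ w, ∀ q ∈ S, M.IsDead (M.evalFrom q w) := by
    intro S
    induction S using Finset.induction_on with
    | empty => exact fun _ => ⟨[], by simp⟩
    | insert r S _ ih =>
      intro hS
      obtain ⟨w, hw⟩ := ih fun q hq => hS q (Finset.mem_insert_of_mem hq)
      -- The image of `r` under `w` is reachable, hence not universal, and some `x` leads it to a
      -- dead state.
      have hr := hu _ ((hS r (Finset.mem_insert_self r S)).evalFrom w)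
      obtain ⟨x, hx⟩ := not_forall_not.1 hr
      refine ⟨w ++ x, fun q hq => ?_⟩
      rw [evalFrom_of_append]
      rcases Finset.mem_insert.1 hq with rfl | hq
      · exact hx
      · exact (hw q hq).evalFrom x
  have := Fintype.ofFinite σ
  obtain ⟨w, hw⟩ := key (Finset.univ.filter M.IsReachable) (by simp)
  have hw' : w ∈ M.accepts.factors := h ▸ Set.mem_univ w
  obtain ⟨q, hq, hq'⟩ := M.mem_factors_accepts.1 hw'
  exact hq' (hw q (by simpa using hq))

theorem mem_coreach_accept (q : σ) : q ∈ M.coreach M.accept ↔ ¬ M.IsDead q :=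
  not_forall_not.symm

theorem factors_accepts_eq_top_iff_coreach [Finite σ] :
    M.accepts.factors = ⊤ ↔ M.start ∈ M.coreach (M.coreach (M.coreach M.accept)ᶜ)ᶜ := by
  have h₁ : (M.coreach M.accept)ᶜ = {q | M.IsDead q} := by
    ext q
    simp [mem_coreach_accept]
  have h₂ : (M.coreach {q | M.IsDead q})ᶜ = {q | M.IsUniversalState q} := by
    ext q
    simp [coreach, IsUniversalState]
  rw [factors_accepts_eq_top_iff, h₁, h₂]
  constructor
  · rintro ⟨_, ⟨x, rfl⟩, h⟩
    exact ⟨x, h⟩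
  · rintro ⟨x, h⟩
    exact ⟨_, ⟨x, rfl⟩, h⟩

/-- The same word serves on both sides. A word that is not a factor leads every state to the only
dead state. Conversely, a synchronizing word leads every state where it leads `d`, and that is a
dead state. -/
theorem exists_notMem_factors_iff (hM : M.InitiallyConnected) (hd : ∃! d, M.IsDead d) :
    (∃ x, x ∉ M.accepts.factors) ↔ M.HasSynchronizingWord := by
  obtain ⟨d, hd, hd'⟩ := hd
  refine exists_congr fun w => ?_
  rw [mem_factors_accepts]
  push Not
  constructor
  · intro h p q
    rw [hd' _ (h p (hM p)), hd' _ (h q (hM q))]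
  · intro h q _
    rw [h q d]
    exact hd.evalFrom w

theorem trim_evalFrom (q : {q : σ // M.IsReachable q}) (x : List α) :
    (M.trim.evalFrom q x).1 = M.evalFrom q.1 x := by
  induction x generalizing q with
  | nil => rfl
  | cons a x ih => exact ih _

theorem trim_accepts : M.trim.accepts = M.accepts := by
  ext x
  rw [mem_accepts, mem_accepts]
  change (M.trim.evalFrom _ x).1 ∈ M.accept ↔ _
  rw [trim_evalFrom]
  rfl

theorem trim_initiallyConnected : M.trim.InitiallyConnected := by
  rintro ⟨_, x, rfl⟩
  exact ⟨x, Subtype.ext (M.trim_evalFrom _ x)⟩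

theorem trim_isDead (q : {q : σ // M.IsReachable q}) : M.trim.IsDead q ↔ M.IsDead q.1 :=
  forall_congr' fun x => not_congr (by
    change (M.trim.evalFrom q x).1 ∈ M.accept ↔ _
    rw [trim_evalFrom])

theorem trim_isUniversalState (q : {q : σ // M.IsReachable q}) :
    M.trim.IsUniversalState q ↔ M.IsUniversalState q.1 :=
  forall_congr' fun x => not_congr (by rw [trim_isDead, trim_evalFrom])

theorem mergeDead_evalFrom (q : σ) (x : List α) :
    M.mergeDead.evalFrom (Quotient.mk M.deadSetoid q) x =
      Quotient.mk M.deadSetoid (M.evalFrom q x) := by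
  induction x generalizing q with
  | nil => rfl
  | cons a x ih => exact ih _

/-- Dead states are not accepting, as the empty word shows, so merging them never mixes accepting
and other states. -/
theorem mk_mem_mergeDead_accept (q : σ) :
    Quotient.mk M.deadSetoid q ∈ M.mergeDead.accept ↔ q ∈ M.accept := by
  constructor
  · rintro ⟨p, hp, hpq⟩
    rcases Quotient.exact hpq with rfl | ⟨hd, -⟩
    · exact hp
    · exact absurd hp (hd [])
  · exact fun h => ⟨q, h, rfl⟩

theorem mergeDead_accepts : M.mergeDead.accepts = M.accepts := by
  ext x
  rw [mem_accepts, mem_accepts]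
  change M.mergeDead.evalFrom (Quotient.mk M.deadSetoid M.start) x ∈ _ ↔ _
  rw [mergeDead_evalFrom, mk_mem_mergeDead_accept]
  rfl

theorem mergeDead_initiallyConnected (h : M.InitiallyConnected) :
    M.mergeDead.InitiallyConnected := by
  intro c
  induction c using Quotient.inductionOn with
  | h q =>
    obtain ⟨x, rfl⟩ := h q
    exact ⟨x, M.mergeDead_evalFrom _ x⟩

theorem mergeDead_isDead (q : σ) :
    M.mergeDead.IsDead (Quotient.mk M.deadSetoid q) ↔ M.IsDead q :=
  forall_congr' fun x => not_congr (by rw [mergeDead_evalFrom, mk_mem_mergeDead_accept])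

theorem mergeDead_isUniversalState (q : σ) :
    M.mergeDead.IsUniversalState (Quotient.mk M.deadSetoid q) ↔ M.IsUniversalState q :=
  forall_congr' fun x => not_congr (by rw [mergeDead_evalFrom, mergeDead_isDead])

theorem mergeDead_existsUnique_isDead {q : σ} (h : M.IsDead q) : ∃! d, M.mergeDead.IsDead d := by
  refine ⟨Quotient.mk M.deadSetoid q, (M.mergeDead_isDead q).2 h, fun c hc => ?_⟩
  induction c using Quotient.inductionOn with
  | h p => exact Quotient.sound (Or.inr ⟨(M.mergeDead_isDead p).1 hc, h⟩)

theorem exists_trim_mergeDead_isUniversalState :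
    (∃ c, M.trim.mergeDead.IsUniversalState c) ↔ ∃ q, M.IsReachable q ∧ M.IsUniversalState q := by
  constructor
  · rintro ⟨c, hc⟩
    induction c using Quotient.inductionOn with
    | h q =>
      rw [mergeDead_isUniversalState, trim_isUniversalState] at hc
      exact ⟨q.1, q.2, hc⟩
  · rintro ⟨q, hq, hu⟩
    exact ⟨Quotient.mk _ ⟨q, hq⟩, (M.trim.mergeDead_isUniversalState _).2
      ((M.trim_isUniversalState _).2 hu)⟩

end DFA

/-! ### The theorem. -/

theorem mainTheorem2 :
    -- universality for factors is decidable in polynomial time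
    DFAInput.PolyTimeDecidable (fun A => A.dfa.accepts.factors = ⊤) ∧
    -- so is the existence of a synchronizing word
    DFAInput.PolyTimeDecidable (fun A => A.dfa.HasSynchronizingWord) ∧
    -- the lemma on synchronizing words
    (∀ {α : Type u} {σ : Type v} [Finite α] [Finite σ] (M : DFA α σ),
      M.InitiallyConnected → (∀ q, ¬ M.IsUniversalState q) → (∃! d, M.IsDead d) →
        ((∃ x, x ∉ M.accepts.factors) ↔ M.HasSynchronizingWord)) ∧
    -- a reachable universal state makes the factors universal
    (∀ {α : Type u} {σ : Type v} [Finite α] [Finite σ] (M : DFA α σ),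
      (∃ q, M.IsReachable q ∧ M.IsUniversalState q) → M.accepts.factors = ⊤) ∧
    -- trimming and merging the dead states, without changing the language, brings every DFA
    -- that has no reachable universal state into the situation of the lemma
    (∀ {α : Type u} {σ : Type v} [Finite α] [Finite σ] (M : DFA α σ),
      M.trim.mergeDead.accepts = M.accepts ∧
      M.trim.mergeDead.InitiallyConnected ∧
      ((∃ c, M.trim.mergeDead.IsUniversalState c) ↔
        ∃ q, M.IsReachable q ∧ M.IsUniversalState q) ∧
      ((¬ ∃ q, M.IsReachable q ∧ M.IsUniversalState q) →
        (∃! d, M.trim.mergeDead.IsDead d) ∧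
        (M.accepts.factors ≠ ⊤ ↔ M.trim.mergeDead.HasSynchronizingWord))) := by
  refine ⟨?_, ?_, ?_, ?_, ?_⟩
  · exact DFAInput.polyTimeDecidable_of_cmd Cmd.universal fun A =>
      DFAInput.run_universal.trans A.dfa.factors_accepts_eq_top_iff_coreach.symm
  · exact DFAInput.polyTimeDecidable_of_cmd Cmd.synchronizing fun A => DFAInput.run_synchronizing
  · intro α σ _ _ M hM _ hd
    exact M.exists_notMem_factors_iff hM hd
  · intro α σ _ _ M h
    exact M.factors_accepts_eq_top_of_universal h
  · intro α σ _ _ M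
    have hL : M.trim.mergeDead.accepts = M.accepts :=
      M.trim.mergeDead_accepts.trans M.trim_accepts
    have hC := M.trim.mergeDead_initiallyConnected M.trim_initiallyConnected
    refine ⟨hL, hC, M.exists_trim_mergeDead_isUniversalState, fun hu => ?_⟩
    have hd : ∃! d, M.trim.mergeDead.IsDead d := by
      -- The start state is reachable and hence not universal, which yields a reachable dead state;
      -- without it there would be nothing to merge into the one dead state.
      have hs : ¬ M.IsUniversalState M.start := fun h => hu ⟨M.start, ⟨[], rfl⟩, h⟩
      obtain ⟨x, hx⟩ := not_forall_not.1 hs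
      exact M.trim.mergeDead_existsUnique_isDead (q := ⟨M.evalFrom M.start x, x, rfl⟩)
        ((M.trim_isDead _).2 hx)
    refine ⟨hd, ?_⟩
    rw [← M.trim.mergeDead.exists_notMem_factors_iff hC hd, hL]
    exact Set.ne_univ_iff_exists_notMem _
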